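/- Let $n\ge 0$, let $\mathcal{C}\ell_{0,n}$ be the real Clifford algebra with unit $e_0=1$ and generators $e_1,\dots,e_n$, $e_ie_j+e_je_i=-2\delta_{ij}$, with any norm on this finite-dimensional space. Write points of $\mathbb{R}^{n+1}$ as $y=(y_0,y_1,\dots,y_n)$, let $D=\frac{\partial}{\partial y_0}+\sum_{j=1}^n e_j\frac{\partial}{\partial y_j}$ be the generalized Cauchy–Riemann operator, and put $\vec y_j=y_0e_j-y_je_0$ for $1\le j\le n$. Let $\lambda\in\mathcal{C}\ell_{0,n}$ and let $\Omega\subseteq\mathbb{R}^{n+1}$ be open. Denote by $\mathcal{M}_\lambda(\Omega)$ the set of functions with values in $\mathcal{C}\ell_{0,n}$ that are continuous on $\overline\Omega$, real differentiable in $\Omega$, and satisfy $Df=f\lambda$ in $\Omega$. A function $f$ is called $\lambda$-differentiable at $y$ if there are $A_1,\dots,A_n\in\mathcal{C}\ell_{0,n}$ such that $$f(y+h)=f(y)e^{h_0\lambda}+\sum_{j=1}^n\vec h_jA_je^{y_0\lambda}+o(|h|)\qquad(h\to0);$$ the form $l(h)=\sum_j\vec h_jA_je^{y_0\lambda}$ is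 its $\lambda$-derivative at $y$. It is infinitely $\lambda$-differentiable in $\Omega$ if it is $k$ times $\lambda$-differentiable in $\Omega$ for every $k$; here every function is $0$ times $\lambda$-differentiable, and $f$ is $k+1$ times $\lambda$-differentiable if it is $\lambda$-differentiable at every $y\in\Omega$ with coefficients $A_j(y)$ such that each function $y\mapsto A_j(y)e^{y_0\lambda}$ is $k$ times $\lambda$-differentiable in $\Omega$. For a multi-index $\beta\in\mathbb{N}^n$, $|\beta|=k$, and $a_1,\dots,a_n\in\mathcal{C}\ell_{0,n}$ let $a^\beta$ be the symmetric product $\frac1{k!}\sum_{\sigma\in S_k}b_{\sigma(1)}\cdots b_{\sigma(k)}$, where $b_1,\dots,b_k$ lists each $a_j$ exactly $\beta_j$ times ($a^0=1$). Theorem (Taylor series for $\mathcal{M}_\lambda$). Every $f\in\mathcal{M}_\lambda(\Omega)$ is infinitely $\lambda$-differentiable in $\Omega$, and for every point $a\in\Omega$ there are coefficients $c_\beta\in\mathcal{C}\ell_{0,n}$ $(\beta\in\mathbb{N}^n)$ such that for all $y$ in some neighbourhood of $a$ $$f(y)=\sum_{\beta\in\mathbb{N}^n}(\vec y-\vec a)^\beta\,c_\beta\,e^{y_0\lambda},$$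 the series being unconditionally convergent. -/

import Mathlib

open Filter Topology Asymptotics

noncomputable section

/-- The negative definite quadratic form `v ↦ -∑ v_j²` on `ℝⁿ`. -/
def negSumSq (n : ℕ) : QuadraticForm ℝ (Fin n → ℝ) :=
  QuadraticMap.weightedSumSquares ℝ (fun _ : Fin n => (-1 : ℝ))

theorem negSumSq_apply {n : ℕ} (v : Fin n → ℝ) : negSumSq n v = ∑ i, -(v i * v i) := by
  simp [negSumSq, QuadraticMap.weightedSumSquares_apply]

/-- The real Clifford algebra with `n` anticommuting generators of square `-1`. -/
abbrev Cl (n : ℕ) : Type := CliffordAlgebra (negSumSq n)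

/-- The points `y = (y₀, y₁, …, yₙ)` of `ℝⁿ⁺¹`. -/
abbrev Pt (n : ℕ) : Type := EuclideanSpace ℝ (Fin (n + 1))

namespace Cl

variable {n : ℕ}

/-- The generators `e₁, …, eₙ`, indexed by `Fin n`. -/
def e (j : Fin n) : Cl n := CliffordAlgebra.ι (negSumSq n) (Pi.single j 1)

theorem e_sq (j : Fin n) : e j * e j = -1 := by
  have h : negSumSq n (Pi.single j 1) = -1 := by
    rw [negSumSq_apply, Finset.sum_eq_single j] <;> simp +contextual
  rw [e, CliffordAlgebra.ι_sq_scalar, h, map_neg, map_one]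

theorem e_mul_e {i j : Fin n} (h : i ≠ j) : e i * e j + e j * e i = 0 := by
  have h0 : QuadraticMap.polar (negSumSq n) (Pi.single i 1) (Pi.single j 1) = 0 := by
    rw [QuadraticMap.polar, negSumSq_apply, negSumSq_apply, negSumSq_apply,
      ← Finset.sum_sub_distrib, ← Finset.sum_sub_distrib]
    refine Finset.sum_eq_zero fun k _ => ?_
    by_cases hi : k = i
    · subst hi
      simp [h]
    · simp [hi]
  rw [e, e, CliffordAlgebra.ι_mul_ι_add_swap, h0, map_zero]

/-- The basis of the ordered products `e_A`, `A ⊆ {1, …, n}`, transported from the exterior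
algebra. -/
def stdBasis (n : ℕ) : Module.Basis (Finset (Fin n)) ℝ (Cl n) :=
  ((Pi.basisFun ℝ (Fin n)).ExteriorAlgebra).map (CliffordAlgebra.equivExterior (negSumSq n)).symm

/-- The coordinates of a Clifford number in the basis `e_A`. -/
def coords (n : ℕ) : Cl n ≃ₗ[ℝ] EuclideanSpace ℝ (Finset (Fin n)) :=
  (stdBasis n).equivFun.trans (WithLp.linearEquiv 2 ℝ (Finset (Fin n) → ℝ)).symm

/-- Left multiplications, as operators on the Euclidean space with orthonormal basis `e_A`. -/
def leftRegular (n : ℕ) :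
    Cl n →ₐ[ℝ] (EuclideanSpace ℝ (Finset (Fin n)) →L[ℝ] EuclideanSpace ℝ (Finset (Fin n))) :=
  (((Module.End.toContinuousLinearMap (𝕜 := ℝ)
    (EuclideanSpace ℝ (Finset (Fin n)))).toAlgHom).comp
      ((coords n).conjAlgEquiv ℝ).toAlgHom).comp (Algebra.lmul ℝ (Cl n))

theorem leftRegular_apply (a : Cl n) (v : EuclideanSpace ℝ (Finset (Fin n))) :
    leftRegular n a v = coords n (a * (coords n).symm v) := rfl

theorem leftRegular_injective : Function.Injective (leftRegular n) := by
  intro a b h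
  have h1 := DFunLike.congr_fun h (coords n 1)
  simpa [leftRegular_apply] using h1

/-- Clifford numbers carry the operator norm of their left multiplications (as `Cl n` is finite
dimensional, every norm gives the same topology and the same little-o relations). -/
instance instNormedRing : NormedRing (Cl n) :=
  NormedRing.induced (Cl n) _ (leftRegular n) leftRegular_injective

instance instNormedAlgebra : NormedAlgebra ℝ (Cl n) :=
  NormedAlgebra.induced ℝ (Cl n) _ (leftRegular n)

end Cl

/-- The monomials `y⃗_j = y₀ e_j - y_j e₀`, `1 ≤ j ≤ n`, where `e₀ = 1`. -/
def monom {n : ℕ} (y : Pt n) (j : Fin n) : Cl n :=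
  y 0 • Cl.e j - y j.succ • (1 : Cl n)

/-- The symmetric product `a₁ × ⋯ × a_k = (1/k!) ∑_σ a_{σ 1} ⋯ a_{σ k}`. -/
def symProd {A : Type*} [Ring A] [Algebra ℝ A] {k : ℕ} (a : Fin k → A) : A :=
  ((k.factorial : ℝ)⁻¹) • ∑ σ : Equiv.Perm (Fin k), (List.ofFn fun i => a (σ i)).prod

/-- The symmetric power `a^β`: the symmetric product with `β j` factors equal to `a j`. -/
def symPow {A : Type*} [Ring A] [Algebra ℝ A] {n : ℕ} (a : Fin n → A) (β : Fin n → ℕ) : A :=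
  symProd ((List.finRange n).flatMap fun j => List.replicate (β j) (a j)).get

/-- The function `y ↦ e^{y₀ λ}`. -/
def expLam {n : ℕ} (lam : Cl n) (y : Pt n) : Cl n := NormedSpace.exp (y 0 • lam)

/-- The partial derivative `∂f/∂y_i`, `0 ≤ i ≤ n`. -/
def pderiv {n : ℕ} (i : Fin (n + 1)) (f : Pt n → Cl n) (y : Pt n) : Cl n :=
  fderiv ℝ f y (EuclideanSpace.single i 1)

/-- The generalized Cauchy–Riemann operator `D = ∂/∂y₀ + ∑ e_j ∂/∂y_j`. -/
def cauchyRiemann {n : ℕ} (f : Pt n → Cl n) (y : Pt n) : Cl n :=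
  pderiv 0 f y + ∑ j : Fin n, Cl.e j * pderiv j.succ f y

/-- Membership in `𝓜_λ(Ω)`: solutions of `D f = f λ` in `Ω`, continuous on the closure of `Ω`. -/
structure LambdaMonogenic {n : ℕ} (lam : Cl n) (Ω : Set (Pt n)) (f : Pt n → Cl n) : Prop where
  continuousOn_closure : ContinuousOn f (closure Ω)
  differentiableOn : DifferentiableOn ℝ f Ω
  cauchyRiemann_eq : ∀ y ∈ Ω, cauchyRiemann f y = f y * lam

/-- The `λ`-linear form `l(h) = ∑ h⃗_j A_j e^{y₀ λ}` is the `λ`-derivative of `f` at `y`: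
`f(y + h) = f(y) e^{h₀ λ} + l(h) + o(|h|)` as `h → 0`. -/
def HasLambdaDerivAt {n : ℕ} (lam : Cl n) (f : Pt n → Cl n) (A : Fin n → Cl n) (y : Pt n) : Prop :=
  (fun h : Pt n => f (y + h) - f y * expLam lam h - ∑ j, monom h j * A j * expLam lam y)
    =o[𝓝 0] (fun h : Pt n => h)

/-- `f` is `k` times `λ`-differentiable in `Ω`: it is `λ`-differentiable at every point of `Ω`, and
the coefficients `A_j(y) e^{y₀ λ}` of its `λ`-derivative are `k - 1` times `λ`-differentiable. -/
def LambdaDifferentiableOn {n : ℕ} (lam : Cl n) (Ω : Set (Pt n)) : ℕ → (Pt n → Cl n) → Prop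
  | 0, _ => True
  | k + 1, f => ∃ A : Fin n → Pt n → Cl n,
      (∀ y ∈ Ω, HasLambdaDerivAt lam f (fun j => A j y) y) ∧
      ∀ j, LambdaDifferentiableOn lam Ω k (fun y => A j y * expLam lam y)

/-- `f` is infinitely `λ`-differentiable in `Ω`. -/
def InfinitelyLambdaDifferentiableOn {n : ℕ} (lam : Cl n) (Ω : Set (Pt n)) (f : Pt n → Cl n) :
    Prop :=
  ∀ k, LambdaDifferentiableOn lam Ω k f

end

/-! ### Paravectors and a divergence identity for monogenic functions -/

section Paravectors

open MeasureTheory Set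

variable {n : ℕ}

/-! Right multiplication by `e^{-y₀λ}` commutes with left multiplication by the `e_j`, so it turns
`D f = f λ` into `D g = 0` (`LambdaMonogenic.isMonogenic`), and everything reduces to the Taylor
series of a monogenic `g`.

Only real differentiability is given, so smoothness has to be proved. The divergence theorem for
fields that are merely differentiable, applied to `κ(|y|²) ȳ e_i g`, yields the mean value property
for a radial bump (`IsMonogenic.integral_radialBump_smul`). Hence `g` is locally a convolution with
a test function: it is smooth, and its derivative is bounded by its supremum on a ball
(`IsMonogenic.regular`). Iterating this estimate on balls of suitable radii bounds derivatives of
order `k` by `C^k k! M` (`IsMonogenic.norm_negPartials_le_factorial`), so Taylor series along short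
segments converge.

The equation `D g = 0` eliminates `∂₀`, so that `dg(h) = ∑ h⃗_j (-∂_j g)`
(`IsMonogenic.fderiv_apply`). Iteration writes the `k`-th directional derivative as a sum over words
of length `k`. Partial derivatives commute, so the products of the `h⃗_j` may be symmetrised;
grouping words by their multi-index gives the series. The same formula for `dg` makes `g e^{y₀λ}`
`λ`-differentiable with coefficients of the same kind, whence infinite `λ`-differentiability. -/

instance Cl.finite_real : Module.Finite ℝ (Cl n) := Module.Finite.of_basis (Cl.stdBasis n)

instance Cl.complete : CompleteSpace (Cl n) := FiniteDimensional.complete ℝ (Cl n)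

/-- The embedding `y ↦ y₀ + ∑ y_j e_j` of `ℝⁿ⁺¹` as the paravectors. -/
noncomputable def paravector (n : ℕ) : (Fin (n + 1) → ℝ) →L[ℝ] Cl n :=
  LinearMap.toContinuousLinearMap
    ((LinearMap.toSpanSingleton ℝ (Cl n) 1).comp (LinearMap.proj 0) +
      (CliffordAlgebra.ι (negSumSq n)).comp (LinearMap.funLeft ℝ ℝ Fin.succ))

/-- The conjugate paravector `y₀ - ∑ y_j e_j`. -/
noncomputable def conjParavector (n : ℕ) : (Fin (n + 1) → ℝ) →L[ℝ] Cl n :=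
  LinearMap.toContinuousLinearMap
    ((LinearMap.toSpanSingleton ℝ (Cl n) 1).comp (LinearMap.proj 0) -
      (CliffordAlgebra.ι (negSumSq n)).comp (LinearMap.funLeft ℝ ℝ Fin.succ))

theorem paravector_apply (y : Fin (n + 1) → ℝ) :
    paravector n y = y 0 • (1 : Cl n) + CliffordAlgebra.ι (negSumSq n) (fun j => y j.succ) := rfl

theorem conjParavector_apply (y : Fin (n + 1) → ℝ) :
    conjParavector n y = y 0 • (1 : Cl n) - CliffordAlgebra.ι (negSumSq n) (fun j => y j.succ) :=
  rfl

theorem paravector_single_zero : paravector n (Pi.single 0 1) = 1 := by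
  have : (fun j : Fin n => (Pi.single 0 1 : Fin (n + 1) → ℝ) j.succ) = 0 := by
    ext j; simp
  rw [paravector_apply, this]; simp

theorem paravector_single_succ (j : Fin n) : paravector n (Pi.single j.succ 1) = Cl.e j := by
  have : (fun i : Fin n => (Pi.single j.succ 1 : Fin (n + 1) → ℝ) i.succ) = Pi.single j 1 := by
    ext i; simp [Pi.single_apply]
  rw [paravector_apply, this, Cl.e]; simp

/-- The square of the Euclidean norm. -/
def sumSq {m : ℕ} (y : Fin m → ℝ) : ℝ := ∑ i, y i ^ 2

theorem conjParavector_mul_paravector (y : Fin (n + 1) → ℝ) :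
    conjParavector n y * paravector n y = sumSq y • (1 : Cl n) := by
  rw [conjParavector_apply, paravector_apply, sumSq, Fin.sum_univ_succ, sub_mul, mul_add, mul_add,
    CliffordAlgebra.ι_sq_scalar, negSumSq_apply, Algebra.algebraMap_eq_smul_one]
  simp only [smul_mul_assoc, mul_smul_comm, one_mul, mul_one, Finset.sum_neg_distrib, neg_smul,
    smul_smul, add_smul, pow_two]
  abel

theorem conjParavector_single_mul (i : Fin (n + 1)) :
    conjParavector n (Pi.single i 1) * paravector n (Pi.single i 1) = 1 := by
  rw [conjParavector_mul_paravector]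
  simp [sumSq, Pi.single_apply]

theorem sum_smul_paravector_single (y : Fin (n + 1) → ℝ) :
    ∑ i, y i • paravector n (Pi.single i 1) = paravector n y := by
  conv_rhs => rw [pi_eq_sum_univ' y, map_sum]
  refine Finset.sum_congr rfl fun i _ => ?_
  rw [← map_smul]

theorem sumSq_nonneg {m : ℕ} (y : Fin m → ℝ) : 0 ≤ sumSq y :=
  Finset.sum_nonneg fun _ _ => sq_nonneg _

theorem contDiff_sumSq {m : ℕ} {k : WithTop ℕ∞} : ContDiff ℝ k (sumSq (m := m)) := by
  unfold sumSq
  fun_prop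

theorem hasFDerivAt_sumSq {m : ℕ} (y : Fin m → ℝ) :
    HasFDerivAt sumSq (∑ i, (2 * y i) • ContinuousLinearMap.proj (R := ℝ) (φ := fun _ => ℝ) i) y := by
  unfold sumSq
  refine HasFDerivAt.fun_sum fun i _ => ?_
  have := ((ContinuousLinearMap.proj (R := ℝ) (φ := fun _ : Fin m => ℝ) i).hasFDerivAt (x := y)).pow 2
  simpa using this

/-- Real differentiable functions in the kernel of the Cauchy–Riemann operator. -/
structure IsMonogenic (g : (Fin (n + 1) → ℝ) → Cl n) (Ω : Set (Fin (n + 1) → ℝ)) : Prop where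
  differentiableOn : DifferentiableOn ℝ g Ω
  sum_eq_zero : ∀ y ∈ Ω, ∑ i, paravector n (Pi.single i 1) * fderiv ℝ g y (Pi.single i 1) = 0

/-- Stokes' formula on the unit cube for a monogenic function and the radial kernel
`ȳ κ(|y|²)`. -/
theorem IsMonogenic.integral_radial_smul_eq_zero {g : (Fin (n + 1) → ℝ) → Cl n}
    {Ω : Set (Fin (n + 1) → ℝ)} (hΩ : IsOpen Ω) (hg : IsMonogenic g Ω) (hc : Icc (-1) 1 ⊆ Ω)
    {κ κ' ψ : ℝ → ℝ} (hκ : ∀ s, HasDerivAt κ (κ' s) s) (h0 : ∀ s, 1 ≤ s → κ s = 0)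
    (hψ : ∀ s, 0 ≤ s → (n + 1) * κ s + 2 * s * κ' s = ψ s) (hψc : Continuous ψ) :
    ∫ y in Icc (-1) 1, ψ (sumSq y) • g y = 0 := by
  have hgd : ∀ y ∈ Icc (-1 : Fin (n + 1) → ℝ) 1, HasFDerivAt g (fderiv ℝ g y) y := fun y hy =>
    ((hg.differentiableOn y (hc hy)).differentiableAt (hΩ.mem_nhds (hc hy))).hasFDerivAt
  have hgc : ContinuousOn g (Icc (-1) 1) := hg.differentiableOn.continuousOn.mono hc
  let u : (Fin (n + 1) → ℝ) → ℝ := fun y => κ (sumSq y)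
  let u' : (Fin (n + 1) → ℝ) → ((Fin (n + 1) → ℝ) →L[ℝ] ℝ) := fun y => κ' (sumSq y) •
    (∑ i, (2 * y i) • ContinuousLinearMap.proj (R := ℝ) (φ := fun _ => ℝ) i)
  have hu : ∀ y, HasFDerivAt u (u' y) y := fun y =>
    (hκ (sumSq y)).comp_hasFDerivAt y (hasFDerivAt_sumSq y)
  have hu' : ∀ y i, u' y (Pi.single i 1) = κ' (sumSq y) * (2 * y i) := by
    intro y i
    simp only [u', smul_apply, sum_apply, smul_eq_mul,
      ContinuousLinearMap.proj_apply]
    rw [Finset.sum_eq_single i] <;> simp +contextual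
  let W : Fin (n + 1) → ((Fin (n + 1) → ℝ) →L[ℝ] Cl n) := fun i =>
    ((ContinuousLinearMap.mul ℝ (Cl n)).flip (paravector n (Pi.single i 1))).comp
      (conjParavector n)
  have hW : ∀ i y, W i y = conjParavector n y * paravector n (Pi.single i 1) := fun i y => rfl
  let F : Fin (n + 1) → (Fin (n + 1) → ℝ) → Cl n := fun i y => u y • (W i y * g y)
  let F' : Fin (n + 1) → (Fin (n + 1) → ℝ) → ((Fin (n + 1) → ℝ) →L[ℝ] Cl n) := fun i y =>
    u y • (W i y • fderiv ℝ g y + MulOpposite.op (g y) • W i) + (u' y).smulRight (W i y * g y)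
  have hF : ∀ i, ∀ y ∈ Icc (-1 : Fin (n + 1) → ℝ) 1, HasFDerivAt (F i) (F' i y) y := fun i y hy =>
    (hu y).smul ((W i).hasFDerivAt.mul' (hgd y hy))
  have hdiv : ∀ y ∈ Icc (-1 : Fin (n + 1) → ℝ) 1,
      ∑ i, F' i y (Pi.single i 1) = ψ (sumSq y) • g y := by
    intro y hy
    -- Summed over `i`, the first term vanishes by `D g = 0`, the second gives `(n + 1) κ g`, and
    -- the third gives `2 |y|² κ' g` because `∑ y_i e_i = y` and `ȳ y = |y|²`.
    have h1 : ∀ i, F' i y (Pi.single i 1) =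
        (u y • conjParavector n y) * (paravector n (Pi.single i 1) * fderiv ℝ g y (Pi.single i 1)) +
          u y • g y + (2 * κ' (sumSq y)) •
            (conjParavector n y * (y i • paravector n (Pi.single i 1)) * g y) := by
      intro i
      have : F' i y (Pi.single i 1) = u y • (W i y * fderiv ℝ g y (Pi.single i 1) +
          W i (Pi.single i 1) * g y) + u' y (Pi.single i 1) • (W i y * g y) := rfl
      rw [this, hW, hW, conjParavector_single_mul, hu']
      simp only [one_mul, smul_add, mul_smul_comm, smul_mul_assoc, smul_smul, mul_assoc]
      congr 2
      ring
    rw [Finset.sum_congr rfl fun i _ => h1 i, Finset.sum_add_distrib, Finset.sum_add_distrib,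
      ← Finset.mul_sum, hg.sum_eq_zero y (hc hy), ← Finset.smul_sum, ← Finset.smul_sum,
      ← Finset.sum_mul,
      ← Finset.mul_sum, sum_smul_paravector_single, conjParavector_mul_paravector,
      ← hψ _ (sumSq_nonneg y)]
    simp only [Finset.sum_const, Finset.card_univ, Fintype.card_fin, mul_zero, zero_add,
      smul_mul_assoc, one_mul, smul_smul, add_smul, u, ← Nat.cast_smul_eq_nsmul ℝ]
    push_cast
    congr 2 <;> ring
  -- This form of the divergence theorem asks for differentiability and an integrable divergence,
  -- not for continuous partial derivatives; the divergence `ψ(|y|²) g` is even continuous.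
  have key := integral_divergence_of_hasFDerivAt_off_countable' (E := Cl n) (-1) 1
    (by intro i; simp) F F' ∅ countable_empty
    (fun i y hy => (hF i y hy).continuousAt.continuousWithinAt)
    (fun y hy i => hF i y (by
      have := hy.1
      simp only [Set.mem_pi, mem_univ, forall_true_left, mem_Ioo] at this
      exact ⟨fun i => (this i).1.le, fun i => (this i).2.le⟩)) (by
      refine IntegrableOn.congr_fun ?_ (fun y hy => (hdiv y hy).symm) measurableSet_Icc
      exact (((hψc.comp (contDiff_sumSq (k := 0)).continuous).continuousOn.smul hgc).integrableOn_compact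
        isCompact_Icc))
  rw [setIntegral_congr_fun measurableSet_Icc hdiv] at key
  rw [key]
  -- On a face of the cube one coordinate is `±1`, so `|y|² ≥ 1` and `κ` vanishes.
  have hface : ∀ (i : Fin (n + 1)) (c : ℝ) (x : Fin n → ℝ), c ^ 2 = 1 →
      F i (i.insertNth c x) = 0 := by
    intro i c x hcc
    have : u (i.insertNth c x) = 0 := by
      refine h0 _ ?_
      rw [sumSq, Fin.sum_univ_succAbove _ i]
      simp only [Fin.insertNth_apply_same, Fin.insertNth_apply_succAbove, hcc]
      linarith [sumSq_nonneg x, show sumSq x = ∑ i, x i ^ 2 from rfl]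
    simp [F, this]
  refine Finset.sum_eq_zero fun i _ => ?_
  simp [hface]
end Paravectors

/-! ### Mean value property against a radial bump -/

section MeanValue

open MeasureTheory Set

/-- A smooth bump function on the line supported in `[1/4, 1/2]`. -/
noncomputable def annularBump : ContDiffBump (3 / 8 : ℝ) := ⟨1 / 16, 1 / 8, by norm_num, by norm_num⟩

theorem annularBump_eq_zero {s : ℝ} (h : s ≤ 1 / 4 ∨ 1 / 2 ≤ s) : annularBump s = 0 := by
  refine annularBump.zero_of_le_dist ?_
  rw [Real.dist_eq]
  show 1 / 8 ≤ _
  rcases h with h | h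
  · rw [abs_of_nonpos] <;> linarith
  · rw [abs_of_nonneg] <;> linarith

/-- The radial profile `κ` of the kernel `ȳ κ(|y|²)` connecting two dilated bump functions. -/
theorem exists_radial_potential {p τ : ℝ} (hτ : 0 < τ) (hτ1 : τ ≤ 1) :
    ∃ κ κ' : ℝ → ℝ, (∀ s, HasDerivAt κ (κ' s) s) ∧ (∀ s, 1 ≤ s → κ s = 0) ∧
      ∀ s, 0 ≤ s →
        2 * p * κ s + 2 * s * κ' s = τ ^ (-p) * annularBump (s / τ) - annularBump s := by
  -- This is `u^(p-1) χ(u)` with `χ` the bump; the cut-off at `1/8`, below the support of `χ`, only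
  -- keeps the power continuous.
  let η : ℝ → ℝ := fun u => max u (1 / 8) ^ (p - 1) * annularBump u
  have hη : Continuous η := by
    refine Continuous.mul ?_ annularBump.continuous
    refine (continuous_id.max continuous_const).rpow_const fun x => Or.inl ?_
    have : (1 / 8 : ℝ) ≤ max x (1 / 8) := le_max_right _ _
    simp only [id]
    linarith
  have hη0 : ∀ u, (u ≤ 1 / 4 ∨ 1 / 2 ≤ u) → η u = 0 := fun u hu => by
    simp [η, annularBump_eq_zero hu]
  have hηs : ∀ s, 0 < s → η s = s ^ (p - 1) * annularBump s := by
    intro s hs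
    by_cases h : s ≤ 1 / 4
    · simp [η, annularBump_eq_zero (Or.inl h)]
    · simp only [η]
      rw [max_eq_left (by linarith)]
  -- For `s > 0` the left side of the equation is `2 s^(1-p) (s^p κ)'`, so the equation says `2 (s^p
  -- κ)' = η(s/τ)/τ - η(s)`. The right side is `Θ'`, which suggests `κ = s^(-p) Θ / 2`.
  let Θ : ℝ → ℝ := fun s => ∫ u in s..s / τ, η u
  have hΘ : ∀ s, HasDerivAt Θ (η (s / τ) / τ - η s) s := by
    intro s
    let P : ℝ → ℝ := fun x => ∫ u in (0 : ℝ)..x, η u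
    have hP : ∀ x, HasDerivAt P (η x) x := fun x =>
      intervalIntegral.integral_hasDerivAt_right (hη.intervalIntegrable _ _)
        (hη.stronglyMeasurableAtFilter _ _) hη.continuousAt
    have e : Θ = fun s => P (s / τ) - P s := by
      funext s
      exact (intervalIntegral.integral_interval_sub_left (hη.intervalIntegrable _ _)
        (hη.intervalIntegrable _ _)).symm
    rw [e]
    have h1 : HasDerivAt (fun s => P (s / τ)) (η (s / τ) * (1 / τ)) s :=
      HasDerivAt.comp (h₂ := P) (h := fun s => s / τ) s (hP (s / τ)) ((hasDerivAt_id' s).div_const τ)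
    have := h1.sub (hP s)
    rwa [mul_one_div] at this
  have hΘlow : ∀ s, s < τ / 4 → Θ s = 0 := by
    intro s hs
    have h2 : s / τ ≤ 1 / 4 := by rw [div_le_iff₀ hτ]; linarith
    refine (intervalIntegral.integral_congr (g := fun _ => 0) fun u hu => ?_).trans (by simp)
    refine hη0 u (Or.inl ?_)
    rcases mem_uIcc.1 hu with h | h <;> linarith [h.2]
  have hΘhigh : ∀ s, 1 / 2 ≤ s → Θ s = 0 := by
    intro s hs
    have h2 : s ≤ s / τ := by rw [le_div_iff₀ hτ]; nlinarith
    refine (intervalIntegral.integral_congr (g := fun _ => 0) fun u hu => ?_).trans (by simp)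
    rw [uIcc_of_le h2] at hu
    exact hη0 u (Or.inr (hs.trans hu.1))
  -- `Θ` vanishes below `τ/4`, so `κ` is zero near every `s ≤ τ/8` and the singularity of `s^(-p)`
  -- at `0` does no harm.
  refine ⟨fun s => s ^ (-p) * Θ s / 2, fun s => if s ≤ τ / 8 then 0 else
    (-p * s ^ (-p - 1) * Θ s + s ^ (-p) * (η (s / τ) / τ - η s)) / 2, fun s => ?_, fun s hs => ?_,
    fun s hs => ?_⟩
  · dsimp only
    split_ifs with h
    · refine (hasDerivAt_const s (0 : ℝ)).congr_of_eventuallyEq ?_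
      filter_upwards [Iio_mem_nhds (show s < τ / 4 by linarith)] with u hu
      simp [hΘlow u hu]
    · have hs : s ≠ 0 := by
        have : 0 < τ / 8 := by positivity
        linarith
      exact (((Real.hasDerivAt_rpow_const (Or.inl hs)).mul (hΘ s)).div_const 2)
  · simp [hΘhigh s (by linarith)]
  · dsimp only
    split_ifs with h
    · have h2 : s / τ ≤ 1 / 4 := by rw [div_le_iff₀ hτ]; linarith
      rw [hΘlow s (by linarith), annularBump_eq_zero (Or.inl h2),
        annularBump_eq_zero (Or.inl (by linarith))]
      simp
    · have hs : 0 < s := by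
        have : 0 < τ / 8 := by positivity
        linarith
      rw [hηs s hs, hηs (s / τ) (by positivity), Real.div_rpow hs.le hτ.le,
        Real.rpow_sub hs, Real.rpow_sub hs, Real.rpow_sub hτ, Real.rpow_neg hs.le,
        Real.rpow_neg hτ.le, Real.rpow_one, Real.rpow_one]
      have h1 : s ^ p ≠ 0 := (Real.rpow_pos_of_pos hs p).ne'
      have h2 : τ ^ p ≠ 0 := (Real.rpow_pos_of_pos hτ p).ne'
      field_simp
      ring

variable {n : ℕ}

/-- A smooth radial bump function supported in the unit ball of `ℝᵐ`. -/
noncomputable def radialBump {m : ℕ} (y : Fin m → ℝ) : ℝ := annularBump (sumSq y)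

theorem contDiff_radialBump {m : ℕ} {k : ℕ∞} : ContDiff ℝ k (radialBump (m := m)) :=
  annularBump.contDiff.comp contDiff_sumSq

theorem radialBump_eq_zero {m : ℕ} {y : Fin m → ℝ} (hy : y ∉ Icc (-1) 1) : radialBump y = 0 := by
  refine annularBump_eq_zero (Or.inr ?_)
  by_contra! h
  refine hy ?_
  have h1 : ∀ i, y i ^ 2 ≤ 1 := fun i =>
    (Finset.single_le_sum (f := fun i => y i ^ 2) (fun _ _ => sq_nonneg _)
      (Finset.mem_univ i)).trans (h.le.trans (by norm_num))
  exact ⟨fun i => (abs_le.1 ((sq_le_one_iff_abs_le_one _).1 (h1 i))).1,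
    fun i => (abs_le.1 ((sq_le_one_iff_abs_le_one _).1 (h1 i))).2⟩

theorem radialBump_nonneg {m : ℕ} (y : Fin m → ℝ) : 0 ≤ radialBump y := annularBump.nonneg

theorem hasCompactSupport_radialBump {m : ℕ} : HasCompactSupport (radialBump (m := m)) :=
  HasCompactSupport.intro isCompact_Icc fun _ => radialBump_eq_zero

theorem radialBump_neg {m : ℕ} (y : Fin m → ℝ) : radialBump (-y) = radialBump y := by
  simp [radialBump, sumSq]

theorem continuous_radialBump {m : ℕ} : Continuous (radialBump (m := m)) :=
  (contDiff_radialBump (k := 0)).continuous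

theorem integral_radialBump_pos : 0 < ∫ y : Fin (n + 1) → ℝ, radialBump y := by
  refine continuous_radialBump.integral_pos_of_hasCompactSupport_nonneg_nonzero
    hasCompactSupport_radialBump radialBump_nonneg
    (x := Pi.single 0 (Real.sqrt (3 / 8))) ?_
  have h : sumSq (Pi.single 0 (Real.sqrt (3 / 8)) : Fin (n + 1) → ℝ) = 3 / 8 := by
    rw [sumSq, Finset.sum_eq_single 0]
    · rw [Pi.single_eq_same, Real.sq_sqrt (by norm_num)]
    · intro i _ hi
      simp [hi]
    · simp
  rw [radialBump, h, annularBump.one_of_mem_closedBall]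
  · exact one_ne_zero
  · exact Metric.mem_closedBall_self annularBump.rIn_pos.le

/-- After a change of variables the difference of the two sides is the integral of `ψ(|y|²) g`,
where `ψ` is the right side in `exists_radial_potential` for `τ = t²` and `p = (n + 1)/2`. The
factor `τ^(-p) = t^(-(n+1))` is the Jacobian. -/
theorem IsMonogenic.integral_radialBump_smul_dilation {g : (Fin (n + 1) → ℝ) → Cl n}
    {Ω : Set (Fin (n + 1) → ℝ)} (hΩ : IsOpen Ω) (hg : IsMonogenic g Ω) (hc : Icc (-1) 1 ⊆ Ω)
    {t : ℝ} (ht : 0 < t) (ht1 : t ≤ 1) :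
    ∫ y, radialBump y • g (t • y) = ∫ y, radialBump y • g y := by
  have hgc : ContinuousOn g (Icc (-1) 1) := hg.differentiableOn.continuousOn.mono hc
  have hτ : 0 < t ^ 2 := by positivity
  obtain ⟨κ, κ', h1, h2, h3⟩ := exists_radial_potential (p := (n + 1) / 2) hτ (by nlinarith)
  have h4 := hg.integral_radial_smul_eq_zero hΩ hc h1 h2
    (ψ := fun s => (t ^ 2) ^ (-((n + 1 : ℝ) / 2)) * annularBump (s / t ^ 2) - annularBump s)
    (fun s hs => by rw [← h3 s hs]; ring)
    ((continuous_const.mul (annularBump.continuous.comp (continuous_id.div_const _))).sub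
      annularBump.continuous)
  have h5 : ∀ y : Fin (n + 1) → ℝ, annularBump (sumSq y / t ^ 2) = radialBump (t⁻¹ • y) := by
    intro y
    rw [radialBump]
    congr 1
    simp [sumSq, mul_pow, ← Finset.mul_sum]
    field_simp
  have h6 : (t ^ 2) ^ (-((n + 1 : ℝ) / 2)) = |(t ^ (n + 1))⁻¹| := by
    rw [abs_of_nonneg (by positivity), ← Real.rpow_natCast, ← Real.rpow_natCast,
      ← Real.rpow_mul ht.le, ← Real.rpow_neg ht.le]
    congr 1
    push_cast
    ring
  have hcont : Continuous fun y : Fin (n + 1) → ℝ => radialBump (t⁻¹ • y) :=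
    continuous_radialBump.comp (continuous_const_smul _)
  have hz : ∀ y : Fin (n + 1) → ℝ, y ∉ Icc (-1) 1 → radialBump (t⁻¹ • y) = 0 := by
    intro y hy
    refine radialBump_eq_zero fun h => hy ?_
    have : ∀ i, |y i| ≤ 1 := by
      intro i
      have h7 : |t⁻¹ * y i| ≤ 1 := abs_le.2 ⟨h.1 i, h.2 i⟩
      rw [abs_mul, abs_of_pos (inv_pos.2 ht), inv_mul_le_iff₀ ht] at h7
      linarith
    exact ⟨fun i => (abs_le.1 (this i)).1, fun i => (abs_le.1 (this i)).2⟩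
  simp only [h5, h6, sub_smul, mul_smul] at h4
  rw [integral_sub, integral_smul, sub_eq_zero,
    setIntegral_eq_integral_of_forall_compl_eq_zero fun y hy => by simp [hz y hy],
    setIntegral_eq_integral_of_forall_compl_eq_zero fun y hy => by
      rw [show annularBump (sumSq y) = 0 from radialBump_eq_zero hy, zero_smul]] at h4
  · rw [show (∫ y : Fin (n + 1) → ℝ, radialBump y • g y) = _ from h4.symm]
    have := Measure.integral_comp_smul (volume : Measure (Fin (n + 1) → ℝ))
      (fun y => radialBump (t⁻¹ • y) • g y) t
    simp only [smul_smul, inv_mul_cancel₀ ht.ne', one_smul, Module.finrank_fin_fun] at this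
    exact this
  · exact ((hcont.continuousOn.smul hgc).integrableOn_compact isCompact_Icc).smul
      |(t ^ (n + 1))⁻¹|
  · exact (continuous_radialBump.continuousOn.smul hgc).integrableOn_compact isCompact_Icc

/-- The dilated integral does not depend on `t`; let `t → 0` by dominated convergence. -/
theorem IsMonogenic.integral_radialBump_smul {g : (Fin (n + 1) → ℝ) → Cl n}
    {Ω : Set (Fin (n + 1) → ℝ)} (hΩ : IsOpen Ω) (hg : IsMonogenic g Ω) (hc : Icc (-1) 1 ⊆ Ω) :
    ∫ y, radialBump y • g y = (∫ y : Fin (n + 1) → ℝ, radialBump y) • g 0 := by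
  have hgc : ContinuousOn g (Icc (-1) 1) := hg.differentiableOn.continuousOn.mono hc
  have h0 : (0 : Fin (n + 1) → ℝ) ∈ Icc (-1 : Fin (n + 1) → ℝ) 1 :=
    ⟨fun i => by simp, fun i => by simp⟩
  obtain ⟨M, hM⟩ := isCompact_Icc.exists_bound_of_continuousOn hgc
  have hmem : ∀ t ∈ Ioc (0 : ℝ) 1, ∀ y ∈ Icc (-1 : Fin (n + 1) → ℝ) 1,
      t • y ∈ Icc (-1 : Fin (n + 1) → ℝ) 1 := by
    intro t ht y hy
    refine ⟨fun i => ?_, fun i => ?_⟩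
    · have := hy.1 i
      simp only [Pi.neg_apply, Pi.one_apply, Pi.smul_apply, smul_eq_mul] at this ⊢
      nlinarith [ht.1, ht.2]
    · have := hy.2 i
      simp only [Pi.one_apply, Pi.smul_apply, smul_eq_mul] at this ⊢
      nlinarith [ht.1, ht.2]
  have hev : ∀ᶠ t : ℝ in 𝓝[>] 0, t ∈ Ioc (0 : ℝ) 1 := Ioc_mem_nhdsGT one_pos
  have hlim : Tendsto (fun t : ℝ => ∫ y, radialBump y • g (t • y)) (𝓝[>] 0)
      (𝓝 (∫ y : Fin (n + 1) → ℝ, radialBump y • g 0)) := by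
    refine tendsto_integral_filter_of_dominated_convergence (fun y => radialBump y * M) ?_ ?_ ?_ ?_
    · filter_upwards [hev] with t ht
      have hs : Function.support (fun y => radialBump y • g (t • y)) ⊆
          Icc (-1 : Fin (n + 1) → ℝ) 1 := by
        intro y hy
        by_contra h
        exact hy (by simp [radialBump_eq_zero h])
      have : ContinuousOn (fun y => radialBump y • g (t • y)) (Icc (-1 : Fin (n + 1) → ℝ) 1) :=
        continuous_radialBump.continuousOn.smul
          (hgc.comp (continuous_const_smul t).continuousOn (hmem t ht))
      exact ((integrableOn_iff_integrable_of_support_subset hs).1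
        (this.integrableOn_compact isCompact_Icc)).aestronglyMeasurable
    · filter_upwards [hev] with t ht
      refine Eventually.of_forall fun y => ?_
      by_cases hy : y ∈ Icc (-1 : Fin (n + 1) → ℝ) 1
      · rw [norm_smul, Real.norm_of_nonneg (radialBump_nonneg y)]
        exact mul_le_mul_of_nonneg_left (hM _ (hmem t ht y hy)) (radialBump_nonneg y)
      · simp [radialBump_eq_zero hy]
    · exact (continuous_radialBump.integrable_of_hasCompactSupport
        hasCompactSupport_radialBump).mul_const M
    · refine Eventually.of_forall fun y => ?_
      refine Tendsto.const_smul ?_ _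
      have h1 : ContinuousAt g 0 := ((hg.differentiableOn 0 (hc h0)).differentiableAt
        (hΩ.mem_nhds (hc h0))).continuousAt
      refine h1.tendsto.comp (Tendsto.mono_left ?_ nhdsWithin_le_nhds)
      have : Continuous fun t : ℝ => t • y := by fun_prop
      simpa using this.tendsto 0
  rw [integral_smul_const] at hlim
  refine tendsto_nhds_unique (Tendsto.congr' ?_ tendsto_const_nhds) hlim
  filter_upwards [hev] with t ht
  exact (hg.integral_radialBump_smul_dilation hΩ hc ht.1 ht.2).symm
end MeanValue

/-! ### Smoothness and the derivative estimate -/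

section Regularity

open MeasureTheory Set

open Metric

open scoped Convolution ContDiff

variable {n : ℕ}

theorem IsMonogenic.comp_affine {g : (Fin (n + 1) → ℝ) → Cl n} {Ω : Set (Fin (n + 1) → ℝ)}
    (hΩ : IsOpen Ω) (hg : IsMonogenic g Ω) (x : Fin (n + 1) → ℝ) (r : ℝ) :
    IsMonogenic (fun z => g (x + r • z)) ((fun z => x + r • z) ⁻¹' Ω) := by
  have h : ∀ z, x + r • z ∈ Ω → HasFDerivAt (fun z => g (x + r • z))
      ((fderiv ℝ g (x + r • z)).comp (r • ContinuousLinearMap.id ℝ (Fin (n + 1) → ℝ))) z := by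
    intro z hz
    have h1 := ((hg.differentiableOn _ hz).differentiableAt (hΩ.mem_nhds hz)).hasFDerivAt
    exact h1.comp z (((hasFDerivAt_id z).const_smul r).const_add x)
  refine ⟨fun z hz => (h z hz).differentiableAt.differentiableWithinAt, fun z hz => ?_⟩
  rw [(h z hz).fderiv]
  simp only [ContinuousLinearMap.comp_apply, smul_apply,
    ContinuousLinearMap.id_apply, map_smul, mul_smul_comm, ← Finset.smul_sum]
  rw [hg.sum_eq_zero _ hz, smul_zero]

/-- The norm on `Fin m → ℝ` is the sup norm, so the cube of the divergence theorem is a ball for the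
estimates. -/
theorem Icc_neg_one_one_eq_closedBall {m : ℕ} : Icc (-1 : Fin m → ℝ) 1 = closedBall 0 1 := by
  ext y
  simp [pi_norm_le_iff_of_nonneg, abs_le, Pi.le_def, forall_and]

/-- The constant in the derivative estimate for monogenic functions. -/
noncomputable def derivConst (n : ℕ) : ℝ :=
  (∫ y : Fin (n + 1) → ℝ, radialBump y)⁻¹ *
    ∫ y : Fin (n + 1) → ℝ, ‖fderiv ℝ radialBump y‖

theorem derivConst_nonneg (n : ℕ) : 0 ≤ derivConst n :=
  mul_nonneg (inv_nonneg.2 integral_radialBump_pos.le) (integral_nonneg fun _ => norm_nonneg _)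

/-- The mean value property at every point of the unit ball exhibits `g` there as a normalised
convolution of the bump with a truncation of `g`. Smoothness is inherited from the bump, and a
derivative may be placed on the bump. -/
theorem IsMonogenic.regular_zero {g : (Fin (n + 1) → ℝ) → Cl n} {Ω : Set (Fin (n + 1) → ℝ)}
    (hΩ : IsOpen Ω) (hg : IsMonogenic g Ω) (hc : closedBall 0 2 ⊆ Ω) :
    ContDiffAt ℝ ∞ g 0 ∧ ∀ M, (∀ y ∈ closedBall 0 2, ‖g y‖ ≤ M) →
      ‖fderiv ℝ g 0‖ ≤ derivConst n * M := by
  let G := (closedBall (0 : Fin (n + 1) → ℝ) 2).indicator g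
  let L := ContinuousLinearMap.lsmul ℝ ℝ (E := Cl n)
  have hc0 := integral_radialBump_pos (n := n)
  set c := ∫ y : Fin (n + 1) → ℝ, radialBump y with hcdef
  have hGint : LocallyIntegrable G :=
    (((hg.differentiableOn.continuousOn.mono hc).integrableOn_compact
      (isCompact_closedBall _ _)).integrable_indicator isClosed_closedBall.measurableSet)
      |>.locallyIntegrable
  have hrep : ∀ w ∈ closedBall (0 : Fin (n + 1) → ℝ) 1,
      g w = c⁻¹ • (radialBump ⋆[L, volume] G) w := by
    intro w hw
    rw [eq_inv_smul_iff₀ hc0.ne', convolution_def]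
    have hwz : ∀ z ∈ Icc (-1 : Fin (n + 1) → ℝ) 1, w + z ∈ closedBall (0 : Fin (n + 1) → ℝ) 2 := by
      intro z hz
      rw [Icc_neg_one_one_eq_closedBall] at hz
      rw [mem_closedBall_zero_iff] at *
      linarith [norm_add_le w z]
    have h1 := (hg.comp_affine hΩ w 1).integral_radialBump_smul
      (hΩ.preimage (by fun_prop)) (fun z hz => by simpa using hc (hwz z hz))
    simp only [one_smul, add_zero] at h1
    -- The bump is even, so the mean over `w + z` is a convolution over `w - z`.
    rw [hcdef, ← h1, ← integral_neg_eq_self]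
    refine integral_congr_ae (Eventually.of_forall fun z => ?_)
    show _ = radialBump z • G (w - z)
    dsimp only
    rw [radialBump_neg, ← sub_eq_add_neg]
    by_cases hz : -z ∈ Icc (-1 : Fin (n + 1) → ℝ) 1
    · have := hwz _ hz
      rw [← sub_eq_add_neg] at this
      simp only [G, indicator_of_mem this]
    · rw [← radialBump_neg, radialBump_eq_zero hz, zero_smul, zero_smul]
  have hev : g =ᶠ[𝓝 0] fun w => c⁻¹ • (radialBump ⋆[L, volume] G) w := by
    filter_upwards [closedBall_mem_nhds (0 : Fin (n + 1) → ℝ) one_pos] with w hw using hrep w hw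
  have hsm : ContDiff ℝ ∞ (radialBump ⋆[L, volume] G) :=
    hasCompactSupport_radialBump.contDiff_convolution_left L contDiff_radialBump hGint
  refine ⟨(hsm.const_smul c⁻¹).contDiffAt.congr_of_eventuallyEq hev, fun M hM => ?_⟩
  have hM0 : 0 ≤ M := (norm_nonneg _).trans (hM 0 (mem_closedBall_self zero_le_two))
  have hd := hasCompactSupport_radialBump.hasFDerivAt_convolution_left L
    (contDiff_radialBump (m := n + 1) (k := 1)) hGint 0
  rw [((hd.const_smul c⁻¹).congr_of_eventuallyEq hev).fderiv, norm_smul, derivConst, ← hcdef,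
    Real.norm_of_nonneg (inv_nonneg.2 hc0.le), mul_assoc]
  refine mul_le_mul_of_nonneg_left ?_ (inv_nonneg.2 hc0.le)
  rw [convolution_def, ← integral_mul_const]
  refine norm_integral_le_of_norm_le ?_ (Eventually.of_forall fun t => ?_)
  · have h1 : Continuous (fderiv ℝ (radialBump (m := n + 1))) :=
      (contDiff_radialBump (k := 1)).continuous_fderiv (by simp)
    exact (h1.norm.integrable_of_hasCompactSupport
      (hasCompactSupport_radialBump.fderiv ℝ).norm).mul_const M
  · have hG : ‖G (0 - t)‖ ≤ M := by
      by_cases h : 0 - t ∈ closedBall (0 : Fin (n + 1) → ℝ) 2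
      · simpa only [G, indicator_of_mem h] using hM _ h
      · simpa only [G, indicator_of_notMem h, norm_zero] using hM0
    refine ContinuousLinearMap.opNorm_le_bound _ (by positivity) fun v => ?_
    have : (L.precompL (Fin (n + 1) → ℝ) (fderiv ℝ radialBump t)) (G (0 - t)) v =
      (fderiv ℝ radialBump t v) • G (0 - t) := rfl
    rw [this, norm_smul]
    calc _ ≤ (‖fderiv ℝ radialBump t‖ * ‖v‖) * M :=
          mul_le_mul (ContinuousLinearMap.le_opNorm _ _) hG (norm_nonneg _) (by positivity)
      _ = _ := by ring

theorem IsMonogenic.regular {g : (Fin (n + 1) → ℝ) → Cl n} {Ω : Set (Fin (n + 1) → ℝ)}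
    (hΩ : IsOpen Ω) (hg : IsMonogenic g Ω) {x : Fin (n + 1) → ℝ} {r : ℝ} (hr : 0 < r)
    (hc : closedBall x (2 * r) ⊆ Ω) :
    ContDiffAt ℝ ∞ g x ∧ ∀ M, (∀ y ∈ closedBall x (2 * r), ‖g y‖ ≤ M) →
      ‖fderiv ℝ g x‖ ≤ derivConst n / r * M := by
  have hmem : ∀ z ∈ closedBall (0 : Fin (n + 1) → ℝ) 2, x + r • z ∈ closedBall x (2 * r) := by
    intro z hz
    rw [mem_closedBall_zero_iff] at hz
    rw [mem_closedBall_iff_norm, add_sub_cancel_left, norm_smul, Real.norm_of_nonneg hr.le]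
    nlinarith
  have h := (hg.comp_affine hΩ x r).regular_zero (hΩ.preimage (by fun_prop))
    (fun z hz => hc (hmem z hz))
  have hxΩ : x ∈ Ω := hc (mem_closedBall_self (by positivity))
  refine ⟨?_, fun M hM => ?_⟩
  · have h1 : ContDiffAt ℝ ∞ ((fun z => g (x + r • z)) ∘ fun y => r⁻¹ • (y - x)) x := by
      refine ContDiffAt.comp x ?_ (by fun_prop)
      simpa using h.1
    refine h1.congr_of_eventuallyEq (Eventually.of_forall fun y => ?_)
    simp [smul_smul, mul_inv_cancel₀ hr.ne']
  · have h2 := h.2 M fun z hz => hM _ (hmem z hz)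
    have h3 : HasFDerivAt (fun z => g (x + r • z))
        ((fderiv ℝ g x).comp (r • ContinuousLinearMap.id ℝ (Fin (n + 1) → ℝ))) 0 := by
      have h1 := ((hg.differentiableOn _ hxΩ).differentiableAt (hΩ.mem_nhds hxΩ)).hasFDerivAt
      refine HasFDerivAt.comp (g := g) 0 ?_ (((hasFDerivAt_id _).const_smul r).const_add x)
      simpa using h1
    rw [h3.fderiv, ContinuousLinearMap.comp_smul, ContinuousLinearMap.comp_id, norm_smul,
      Real.norm_of_nonneg hr.le] at h2
    rw [div_mul_eq_mul_div, le_div_iff₀ hr]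
    linarith
end Regularity

/-! ### Taylor's formula and factorial bounds on derivatives -/

section Taylor

open Metric Set

open scoped ContDiff Nat

variable {n : ℕ}

/-- Taylor's formula with remainder estimate on the unit interval. -/
theorem norm_sub_taylor_le {E : Type*} [NormedAddCommGroup E] [NormedSpace ℝ E] {B : ℝ} (k : ℕ) :
    ∀ S : ℕ → ℝ → E, (∀ i, ∀ t ∈ Icc (0 : ℝ) 1, HasDerivAt (S i) (S (i + 1) t) t) →
      (∀ t ∈ Icc (0 : ℝ) 1, ‖S k t‖ ≤ B) → ∀ t ∈ Icc (0 : ℝ) 1,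
        ‖S 0 t - ∑ i ∈ Finset.range k, (t ^ i / i !) • S i 0‖ ≤ B * (t ^ k / k !) := by
  induction k with
  | zero => intro S _ hB t ht; simpa using hB t ht
  | succ k ih =>
    intro S hS hB
    have hpow : ∀ (i : ℕ) (t : ℝ),
        HasDerivAt (fun t : ℝ => t ^ (i + 1) / ((i + 1)! : ℝ)) (t ^ i / (i ! : ℝ)) t := by
      intro i t
      have := (hasDerivAt_pow (i + 1) t).div_const ((i + 1)! : ℝ)
      refine this.congr_deriv ?_
      rw [Nat.factorial_succ]
      push_cast
      have h1 : (i ! : ℝ) ≠ 0 := by positivity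
      have h2 : (i + 1 : ℝ) ≠ 0 := by positivity
      field_simp
    have hd : ∀ t ∈ Icc (0 : ℝ) 1,
        HasDerivAt (fun t => S 0 t - ∑ i ∈ Finset.range (k + 1), (t ^ i / (i ! : ℝ)) • S i 0)
          (S 1 t - ∑ i ∈ Finset.range k, (t ^ i / (i ! : ℝ)) • S (i + 1) 0) t := by
      intro t ht
      refine (hS 0 t ht).sub ?_
      simp only [Finset.sum_range_succ', pow_zero, Nat.factorial_zero, Nat.cast_one, div_one,
        one_smul]
      refine HasDerivAt.add_const _ ?_
      exact HasDerivAt.fun_sum fun i _ => (hpow i t).smul_const _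
    have hder := ih (fun i => S (i + 1)) (fun i t ht => hS (i + 1) t ht) hB
    -- The derivative of the remainder is the remainder of one order less for the shifted sequence,
    -- already bounded by the derivative of `B t^(k+1)/(k+1)!`.
    refine image_norm_le_of_norm_deriv_right_le_deriv_boundary'
      (fun t ht => (hd t ht).continuousAt.continuousWithinAt)
      (fun t ht => (hd t (Ico_subset_Icc_self ht)).hasDerivWithinAt) ?_ ?_
      (fun t _ => ((hpow k t).const_mul B).hasDerivWithinAt)
      (fun t ht => hder t (Ico_subset_Icc_self ht))
    · simp [Finset.sum_range_succ']
    · fun_prop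

theorem hasSum_taylor {E : Type*} [NormedAddCommGroup E] [NormedSpace ℝ E] [CompleteSpace E]
    {S : ℕ → ℝ → E} {q M : ℝ} (hq0 : 0 ≤ q) (hq : q < 1)
    (hS : ∀ i, ∀ t ∈ Icc (0 : ℝ) 1, HasDerivAt (S i) (S (i + 1) t) t)
    (hB : ∀ k, ∀ t ∈ Icc (0 : ℝ) 1, ‖S k t‖ ≤ q ^ k * k ! * M) :
    HasSum (fun k => ((k ! : ℝ)⁻¹) • S k 0) (S 0 1) := by
  have hsum : Summable fun k => ((k ! : ℝ)⁻¹) • S k 0 := by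
    refine Summable.of_norm_bounded ((summable_geometric_of_lt_one hq0 hq).mul_right M) fun k => ?_
    have hk : (0 : ℝ) < k ! := by positivity
    rw [norm_smul, norm_inv, Real.norm_of_nonneg hk.le, inv_mul_le_iff₀ hk]
    refine (hB k 0 (by simp)).trans (le_of_eq (by ring))
  rw [hsum.hasSum_iff_tendsto_nat, tendsto_iff_norm_sub_tendsto_zero]
  refine squeeze_zero (fun _ => norm_nonneg _) (g := fun k => q ^ k * M) (fun k => ?_) ?_
  · have h := norm_sub_taylor_le k S hS (hB k) 1 (by simp)
    have hk : (k ! : ℝ) ≠ 0 := by positivity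
    rw [norm_sub_rev]
    simp only [one_pow, one_div] at h
    refine h.trans (le_of_eq ?_)
    field_simp
  · simpa using (tendsto_pow_atTop_nhds_zero_of_lt_one hq0 hq).mul_const M

/-- The negative of the `j`-th partial derivative. -/
noncomputable def negPartial (j : Fin n) (g : (Fin (n + 1) → ℝ) → Cl n) (y : Fin (n + 1) → ℝ) :
    Cl n :=
  -fderiv ℝ g y (Pi.single j.succ 1)

/-- The vectors `h⃗_j = h₀ e_j - h_j`. -/
noncomputable def fueter (h : Fin (n + 1) → ℝ) (j : Fin n) : Cl n :=
  h 0 • Cl.e j - h j.succ • (1 : Cl n)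

variable {g : (Fin (n + 1) → ℝ) → Cl n} {Ω : Set (Fin (n + 1) → ℝ)}

theorem IsMonogenic.hasFDerivAt (hΩ : IsOpen Ω) (hg : IsMonogenic g Ω) {y : Fin (n + 1) → ℝ}
    (hy : y ∈ Ω) : HasFDerivAt g (fderiv ℝ g y) y :=
  ((hg.differentiableOn y hy).differentiableAt (hΩ.mem_nhds hy)).hasFDerivAt

/-- Substituting `∂₀ g = -∑ e_j ∂_j g` into `∑ h_i ∂_i g` leaves the combinations `h₀ e_j - h_j` in
front of `-∂_j g`. -/
theorem IsMonogenic.fderiv_apply (hg : IsMonogenic g Ω) {y : Fin (n + 1) → ℝ} (hy : y ∈ Ω)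
    (h : Fin (n + 1) → ℝ) : fderiv ℝ g y h = ∑ j, fueter h j * negPartial j g y := by
  have h0 := hg.sum_eq_zero y hy
  rw [Fin.sum_univ_succ, paravector_single_zero, one_mul] at h0
  simp only [paravector_single_succ] at h0
  conv_lhs => rw [pi_eq_sum_univ' h, map_sum, Fin.sum_univ_succ]
  simp only [map_smul, fueter, negPartial, sub_mul, smul_mul_assoc, one_mul, mul_neg,
    Finset.sum_sub_distrib, Finset.sum_neg_distrib, ← Finset.smul_sum]
  rw [eq_neg_of_add_eq_zero_left h0, smul_neg]
  abel

theorem IsMonogenic.contDiffAt (hΩ : IsOpen Ω) (hg : IsMonogenic g Ω) {y : Fin (n + 1) → ℝ}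
    (hy : y ∈ Ω) : ContDiffAt ℝ ∞ g y := by
  obtain ⟨ε, hε, hs⟩ := Metric.nhds_basis_closedBall.mem_iff.1 (hΩ.mem_nhds hy)
  exact (hg.regular hΩ (half_pos hε) (by rwa [mul_div_cancel₀ _ two_ne_zero])).1

theorem IsMonogenic.hasFDerivAt_fderiv (hΩ : IsOpen Ω) (hg : IsMonogenic g Ω)
    {y : Fin (n + 1) → ℝ} (hy : y ∈ Ω) :
    HasFDerivAt (fderiv ℝ g) (fderiv ℝ (fderiv ℝ g) y) y :=
  (((hg.contDiffAt hΩ hy).fderiv_right (m := 1) (by norm_cast)).differentiableAt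
    (by simp)).hasFDerivAt

theorem IsMonogenic.fderiv_fderiv_comm (hΩ : IsOpen Ω) (hg : IsMonogenic g Ω)
    {y : Fin (n + 1) → ℝ} (hy : y ∈ Ω) (v w : Fin (n + 1) → ℝ) :
    fderiv ℝ (fderiv ℝ g) y v w = fderiv ℝ (fderiv ℝ g) y w v :=
  ((hg.contDiffAt hΩ hy).isSymmSndFDerivAt
    (by rw [minSmoothness_of_isRCLikeNormedField]; exact WithTop.coe_le_coe.2 le_top)).eq v w

theorem IsMonogenic.hasFDerivAt_negPartial (hΩ : IsOpen Ω) (hg : IsMonogenic g Ω)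
    {y : Fin (n + 1) → ℝ} (hy : y ∈ Ω) (j : Fin n) :
    HasFDerivAt (negPartial j g) (-((fderiv ℝ (fderiv ℝ g) y).flip (Pi.single j.succ 1))) y :=
  (((ContinuousLinearMap.apply ℝ (Cl n) (Pi.single j.succ 1 : Fin (n + 1) → ℝ)).hasFDerivAt).comp y
    (hg.hasFDerivAt_fderiv hΩ hy)).neg

/-- Differentiate the identity `D g = 0` in the direction `e_j` and use the symmetry of the second
derivative. -/
theorem IsMonogenic.negPartial (hΩ : IsOpen Ω) (hg : IsMonogenic g Ω) (j : Fin n) :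
    IsMonogenic (negPartial j g) Ω := by
  refine ⟨fun y hy => (hg.hasFDerivAt_negPartial hΩ hy j).differentiableAt.differentiableWithinAt,
    fun y hy => ?_⟩
  rw [(hg.hasFDerivAt_negPartial hΩ hy j).fderiv]
  have h1 : HasFDerivAt (fun z => ∑ i, paravector n (Pi.single i 1) * fderiv ℝ g z (Pi.single i 1))
      (∑ i, (ContinuousLinearMap.mul ℝ (Cl n) (paravector n (Pi.single i 1))).comp
        ((fderiv ℝ (fderiv ℝ g) y).flip (Pi.single i 1))) y := by
    refine HasFDerivAt.fun_sum fun i _ => ?_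
    exact (ContinuousLinearMap.mul ℝ (Cl n) (paravector n (Pi.single i 1))).hasFDerivAt.comp y
      (((ContinuousLinearMap.apply ℝ (Cl n) (Pi.single i 1 : Fin (n + 1) → ℝ)).hasFDerivAt).comp y
        (hg.hasFDerivAt_fderiv hΩ hy))
  have h2 := h1.unique ((hasFDerivAt_const (0 : Cl n) y).congr_of_eventuallyEq (by
    filter_upwards [hΩ.mem_nhds hy] with z hz using hg.sum_eq_zero z hz))
  have h3 := DFunLike.congr_fun h2 (Pi.single j.succ 1)
  simp only [sum_apply, ContinuousLinearMap.comp_apply, ContinuousLinearMap.mul_apply',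
    ContinuousLinearMap.flip_apply, zero_apply] at h3
  simp only [neg_apply, ContinuousLinearMap.flip_apply, mul_neg,
    Finset.sum_neg_distrib, neg_eq_zero]
  simpa only [hg.fderiv_fderiv_comm hΩ hy (Pi.single j.succ 1)] using h3

/-- Iterated `negPartial` along a word of indices. -/
noncomputable def negPartials (g : (Fin (n + 1) → ℝ) → Cl n) :
    List (Fin n) → (Fin (n + 1) → ℝ) → Cl n
  | [] => g
  | j :: l => negPartials (negPartial j g) l

theorem negPartial_congr (hΩ : IsOpen Ω) {g' : (Fin (n + 1) → ℝ) → Cl n} (h : EqOn g g' Ω)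
    (j : Fin n) : EqOn (negPartial j g) (negPartial j g') Ω := by
  intro y hy
  have : g =ᶠ[𝓝 y] g' := by filter_upwards [hΩ.mem_nhds hy] with z hz using h hz
  rw [_root_.negPartial, _root_.negPartial, this.fderiv_eq]

theorem negPartials_congr (hΩ : IsOpen Ω) (l : List (Fin n)) :
    ∀ {g g' : (Fin (n + 1) → ℝ) → Cl n}, EqOn g g' Ω →
      EqOn (negPartials g l) (negPartials g' l) Ω := by
  induction l with
  | nil => intro g g' h; exact h
  | cons j l ih => intro g g' h; exact ih (negPartial_congr hΩ h j)

theorem IsMonogenic.negPartial_comm (hΩ : IsOpen Ω) (hg : IsMonogenic g Ω) (i j : Fin n) :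
    EqOn (_root_.negPartial i (_root_.negPartial j g))
      (_root_.negPartial j (_root_.negPartial i g)) Ω := by
  intro y hy
  rw [_root_.negPartial, _root_.negPartial, (hg.hasFDerivAt_negPartial hΩ hy j).fderiv,
    (hg.hasFDerivAt_negPartial hΩ hy i).fderiv]
  simp only [neg_apply, ContinuousLinearMap.flip_apply]
  rw [hg.fderiv_fderiv_comm hΩ hy]

theorem IsMonogenic.negPartials_perm (hΩ : IsOpen Ω) {l l' : List (Fin n)} (hl : l.Perm l') :
    ∀ {g : (Fin (n + 1) → ℝ) → Cl n}, IsMonogenic g Ω →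
      EqOn (negPartials g l) (negPartials g l') Ω := by
  induction hl with
  | nil => intro g _; exact eqOn_refl _ _
  | cons j _ ih => intro g hg; exact ih (hg.negPartial hΩ j)
  | swap i j l => intro g hg; exact negPartials_congr hΩ l (hg.negPartial_comm hΩ i j)
  | trans _ _ ih1 ih2 => intro g hg; exact (ih1 hg).trans (ih2 hg)

theorem norm_single_one {m : ℕ} (i : Fin m) : ‖(Pi.single i 1 : Fin m → ℝ)‖ = 1 := by
  rw [Pi.norm_single, norm_one]

/-- Each derivative costs a factor `derivConst n / δ` and shrinks the radius by `2 * δ`. -/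
theorem IsMonogenic.norm_negPartials_le (hΩ : IsOpen Ω) {δ : ℝ} (hδ : 0 < δ) (l : List (Fin n)) :
    ∀ {g : (Fin (n + 1) → ℝ) → Cl n} {M : ℝ} {x : Fin (n + 1) → ℝ}, IsMonogenic g Ω →
      closedBall x (l.length * (2 * δ)) ⊆ Ω →
      (∀ y ∈ closedBall x (l.length * (2 * δ)), ‖g y‖ ≤ M) →
      ‖negPartials g l x‖ ≤ (derivConst n / δ) ^ l.length * M := by
  induction l with
  | nil => intro g M x _ _ hM; simpa [negPartials] using hM x (by simp)
  | cons j l ih =>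
    intro g M x hg hc hM
    have hsub : ∀ y ∈ closedBall x (l.length * (2 * δ)),
        closedBall y (2 * δ) ⊆ closedBall x ((j :: l).length * (2 * δ)) := by
      intro y hy
      refine closedBall_subset_closedBall' ?_
      rw [mem_closedBall] at hy
      rw [List.length_cons]
      push_cast
      linarith
    have h := ih (M := derivConst n / δ * M) (hg.negPartial hΩ j)
      ((closedBall_subset_closedBall (by
        rw [List.length_cons]; push_cast; nlinarith)).trans hc) (fun y hy => by
        have h1 := (hg.regular hΩ hδ ((hsub y hy).trans hc)).2 M fun z hz => hM z (hsub y hy hz)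
        rw [_root_.negPartial, norm_neg]
        refine (ContinuousLinearMap.le_opNorm _ _).trans ?_
        rwa [norm_single_one, mul_one])
    rw [List.length_cons, pow_succ, mul_assoc]
    exact h

theorem IsMonogenic.norm_negPartials_le_factorial (hΩ : IsOpen Ω) (hg : IsMonogenic g Ω)
    {R M : ℝ} (hR : 0 < R) {x : Fin (n + 1) → ℝ} (hc : closedBall x R ⊆ Ω)
    (hM : ∀ y ∈ closedBall x R, ‖g y‖ ≤ M) (l : List (Fin n)) :
    ‖negPartials g l x‖ ≤
      (2 * derivConst n * Real.exp 1 / R) ^ l.length * (l.length)! * M := by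
  have hM0 : 0 ≤ M := (norm_nonneg _).trans (hM x (mem_closedBall_self hR.le))
  rcases Nat.eq_zero_or_pos l.length with h0 | hpos
  · rw [List.length_eq_zero_iff] at h0
    subst h0
    simpa [negPartials] using hM x (mem_closedBall_self hR.le)
  set k := l.length with hk
  have hk0 : (0 : ℝ) < k := by exact_mod_cast hpos
  have e : (k : ℝ) * (2 * (R / (2 * k))) = R := by field_simp
  -- The radius `R` is split into `k` equal steps; the resulting `k^k` is absorbed by `k^k ≤ e^k
  -- k!`.
  have h := hg.norm_negPartials_le hΩ (δ := R / (2 * k)) (by positivity) l (x := x) (M := M)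
    (by rwa [← hk, e]) (by rwa [← hk, e])
  refine h.trans (mul_le_mul_of_nonneg_right ?_ hM0)
  have h1 := Real.pow_div_factorial_le_exp (x := (k : ℝ)) hk0.le k
  rw [div_le_iff₀ (by positivity), ← Real.exp_one_rpow, Real.rpow_natCast] at h1
  have h2 : derivConst n / (R / (2 * k)) = (2 * derivConst n / R) * k := by field_simp
  have h3 : 2 * derivConst n * Real.exp 1 / R = (2 * derivConst n / R) * Real.exp 1 := by ring
  rw [← hk, h2, h3, mul_pow, mul_pow, mul_assoc]
  have := derivConst_nonneg n
  exact mul_le_mul_of_nonneg_left h1 (by positivity)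
end Taylor

/-! ### Symmetric products and words -/

section SymmetricProducts

variable {A : Type*} [Ring A] [Algebra ℝ A] {n k m : ℕ}

theorem symProd_eq_of_equiv (E : Fin m ≃ Fin k) {a : Fin m → A} {b : Fin k → A}
    (h : ∀ i, a i = b (E i)) : symProd a = symProd b := by
  obtain rfl : m = k := Fin.equiv_iff_eq.1 ⟨E⟩
  obtain rfl : a = b ∘ E := funext h
  rw [symProd, symProd]
  congr 1
  exact Equiv.sum_comp (Equiv.mulLeft E) fun σ => (List.ofFn fun i => b (σ i)).prod

/-- The multi-index counting the letters of a word. -/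
def wordCount (w : Fin k → Fin n) (j : Fin n) : ℕ := (List.ofFn w).count j

theorem perm_ofFn_wordCount (w : Fin k → Fin n) :
    ((List.finRange n).flatMap fun j => List.replicate (wordCount w j) j).Perm (List.ofFn w) := by
  rw [List.perm_iff_count]
  intro j
  rw [List.count_flatMap]
  have : (List.map (List.count j ∘ fun i => List.replicate (wordCount w i) i)
      (List.finRange n)).sum = ∑ i, if i = j then wordCount w i else 0 := by
    rw [← List.ofFn_eq_map, List.sum_ofFn]
    refine Finset.sum_congr rfl fun i _ => ?_
    simp [List.count_replicate]
  rw [this]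
  simp [wordCount]

/-- The sorted list behind `symPow` is a permutation of the word, and symmetric products ignore the
order of factors. -/
theorem symProd_comp_word (a : Fin n → A) (w : Fin k → Fin n) :
    symProd (fun i => a (w i)) = symPow a (wordCount w) := by
  set l := (List.finRange n).flatMap fun j => List.replicate (wordCount w j) j with hl
  have hp : l.Perm (List.ofFn w) := perm_ofFn_wordCount w
  have hmap : ((List.finRange n).flatMap fun j => List.replicate (wordCount w j) (a j)) =
      l.map a := by
    rw [hl, List.map_flatMap]
    simp
  rw [symPow, hmap]
  symm
  let E : Fin l.length ≃ Fin (List.ofFn w).length :=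
    ⟨hp.idxBij, hp.symm.idxBij, fun _ => hp.idxBij_symm_idxBij, fun _ => hp.idxBij_idxBij_symm⟩
  refine symProd_eq_of_equiv
    ((finCongr (List.length_map a)).trans (E.trans (finCongr List.length_ofFn))) fun i => ?_
  have := hp.getElem_idxBij_eq_getElem (finCongr (List.length_map a) i)
  simp only [List.getElem_ofFn] at this
  simp only [List.get_eq_getElem, List.getElem_map]
  exact congrArg a this.symm

/-- Permuting the letters is a bijection of the words that preserves `G`, so the sum equals its
average over all permutations. -/
theorem sum_prod_word_eq_sum_symProd (z : Fin n → A) {G : (Fin k → Fin n) → A}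
    (hG : ∀ (w : Fin k → Fin n) (σ : Equiv.Perm (Fin k)), G (w ∘ σ) = G w) :
    ∑ w : Fin k → Fin n, (List.ofFn fun i => z (w i)).prod * G w =
      ∑ w : Fin k → Fin n, symProd (fun i => z (w i)) * G w := by
  have h : ∀ σ : Equiv.Perm (Fin k),
      ∑ w : Fin k → Fin n, (List.ofFn fun i => z (w (σ i))).prod * G w =
        ∑ w : Fin k → Fin n, (List.ofFn fun i => z (w i)).prod * G w := by
    intro σ
    rw [← Equiv.sum_comp (Equiv.arrowCongr σ.symm (Equiv.refl (Fin n)))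
      fun w => (List.ofFn fun i => z (w i)).prod * G w]
    refine Finset.sum_congr rfl fun w _ => ?_
    have : Equiv.arrowCongr σ.symm (Equiv.refl (Fin n)) w = w ∘ σ := rfl
    rw [this, hG]
    rfl
  simp only [symProd, smul_mul_assoc, Finset.sum_mul]
  rw [← Finset.smul_sum, Finset.sum_comm, Finset.sum_congr rfl fun σ _ => h σ, Finset.sum_const,
    Finset.card_univ, Fintype.card_perm, Fintype.card_fin, ← Nat.cast_smul_eq_nsmul ℝ, smul_smul,
    inv_mul_cancel₀ (by positivity), one_smul]

theorem norm_list_prod_le_mul_pow {A : Type*} [NormedRing A] {H : ℝ} (hH : 0 ≤ H) (l : List A)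
    (h : ∀ x ∈ l, ‖x‖ ≤ H) : ‖l.prod‖ ≤ H ^ l.length * ‖(1 : A)‖ := by
  induction l with
  | nil => simp
  | cons x l ih =>
    rw [List.prod_cons, List.length_cons, pow_succ', mul_assoc]
    exact (norm_mul_le _ _).trans (mul_le_mul (h x (by simp)) (ih fun y hy => h y (by simp [hy]))
      (norm_nonneg _) hH)

theorem norm_symProd_le {A : Type*} [NormedRing A] [NormedAlgebra ℝ A] {H : ℝ} (hH : 0 ≤ H)
    (a : Fin k → A) (h : ∀ i, ‖a i‖ ≤ H) : ‖symProd a‖ ≤ H ^ k * ‖(1 : A)‖ := by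
  have hk : (0 : ℝ) < k.factorial := by positivity
  rw [symProd, norm_smul, norm_inv, Real.norm_of_nonneg hk.le, inv_mul_le_iff₀ hk]
  refine (norm_sum_le_of_le (f := fun σ : Equiv.Perm (Fin k) => (List.ofFn fun i => a (σ i)).prod)
    _ fun σ _ => ?_).trans_eq (b := ∑ _σ : Equiv.Perm (Fin k), H ^ k * ‖(1 : A)‖) ?_
  · refine (norm_list_prod_le_mul_pow hH _ fun x hx => ?_).trans_eq (by rw [List.length_ofFn])
    obtain ⟨i, rfl⟩ := (List.mem_ofFn' _ _).1 hx
    exact h _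
  · rw [Finset.sum_const, Finset.card_univ, Fintype.card_perm, Fintype.card_fin, nsmul_eq_mul]

end SymmetricProducts

/-! ### Expansion of monogenic functions in symmetric powers -/

section TaylorSeries

open Metric Set

open scoped Nat

variable {n : ℕ} {g : (Fin (n + 1) → ℝ) → Cl n} {Ω : Set (Fin (n + 1) → ℝ)}

/-- The `k`-th derivative of a monogenic function in the direction `h`, in terms of `h⃗_j`. -/
noncomputable def dirDeriv (h : Fin (n + 1) → ℝ) :
    ℕ → ((Fin (n + 1) → ℝ) → Cl n) → (Fin (n + 1) → ℝ) → Cl n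
  | 0, g => g
  | k + 1, g => fun y => ∑ j, fueter h j * dirDeriv h k (negPartial j g) y

theorem IsMonogenic.hasDerivAt_dirDeriv (hΩ : IsOpen Ω) (a h : Fin (n + 1) → ℝ) {t : ℝ}
    (ht : a + t • h ∈ Ω) (k : ℕ) : ∀ {g : (Fin (n + 1) → ℝ) → Cl n}, IsMonogenic g Ω →
      HasDerivAt (fun t : ℝ => dirDeriv h k g (a + t • h)) (dirDeriv h (k + 1) g (a + t • h)) t := by
  induction k with
  | zero =>
    intro g hg
    have h1 : HasDerivAt (fun t : ℝ => a + t • h) h t := by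
      simpa using ((hasDerivAt_id t).smul_const h).const_add a
    have h2 := (hg.hasFDerivAt hΩ ht).comp_hasDerivAt t h1
    rw [hg.fderiv_apply ht h] at h2
    exact h2
  | succ k ih =>
    intro g hg
    exact HasDerivAt.fun_sum fun j _ => (ih (hg.negPartial hΩ j)).const_mul _

theorem dirDeriv_eq_sum (h : Fin (n + 1) → ℝ) (k : ℕ) : ∀ (g : (Fin (n + 1) → ℝ) → Cl n)
    (y : Fin (n + 1) → ℝ), dirDeriv h k g y = ∑ w : Fin k → Fin n,
      (List.ofFn fun i => fueter h (w i)).prod * negPartials g (List.ofFn w) y := by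
  induction k with
  | zero => intro g y; simp [dirDeriv, negPartials]
  | succ k ih =>
    intro g y
    rw [← (Fin.consEquiv fun _ : Fin (k + 1) => Fin n).sum_comp, Fintype.sum_prod_type]
    refine Finset.sum_congr rfl fun j _ => ?_
    rw [ih, Finset.mul_sum]
    refine Finset.sum_congr rfl fun w _ => ?_
    simp [List.ofFn_succ, Fin.consEquiv, negPartials, mul_assoc]

theorem sum_wordCount {k : ℕ} (w : Fin k → Fin n) : ∑ j, wordCount w j = k := by
  have h := (perm_ofFn_wordCount w).length_eq
  rw [List.length_flatMap, List.length_ofFn, ← List.ofFn_eq_map, List.sum_ofFn] at h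
  simpa using h

/-- The multi-index fixes the length `|β|` of the word. -/
theorem finite_wordCount_fiber (β : Fin n → ℕ) :
    Finite {x : Σ k, Fin k → Fin n // wordCount x.2 = β} := by
  refine Set.Finite.to_subtype (s := {x : Σ k, Fin k → Fin n | wordCount x.2 = β}) ?_
  refine (Set.finite_range fun w : Fin (∑ j, β j) → Fin n =>
    (⟨_, w⟩ : Σ k, Fin k → Fin n)).subset ?_
  rintro ⟨k, w⟩ hw
  obtain rfl : wordCount w = β := hw
  have h := sum_wordCount w
  generalize ∑ j, wordCount w j = m at h
  subst h
  exact ⟨w, rfl⟩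

theorem exists_norm_fueter_le (n : ℕ) :
    ∃ H : ℝ, 0 ≤ H ∧ ∀ (h : Fin (n + 1) → ℝ) (j : Fin n), ‖fueter h j‖ ≤ ‖h‖ * H := by
  refine ⟨∑ j : Fin n, ‖Cl.e j‖ + ‖(1 : Cl n)‖, by positivity, fun h j => ?_⟩
  have h1 : ‖Cl.e j‖ ≤ ∑ j : Fin n, ‖Cl.e j‖ :=
    Finset.single_le_sum (f := fun j : Fin n => ‖Cl.e j‖) (fun _ _ => norm_nonneg _)
      (Finset.mem_univ j)
  calc ‖fueter h j‖ ≤ ‖h 0 • Cl.e j‖ + ‖h j.succ • (1 : Cl n)‖ := norm_sub_le _ _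
    _ ≤ ‖h‖ * ‖Cl.e j‖ + ‖h‖ * ‖(1 : Cl n)‖ := by
      rw [norm_smul, norm_smul]
      gcongr <;> exact norm_le_pi_norm h _
    _ ≤ _ := by rw [mul_add]; gcongr

/-- The expansion of a monogenic function in symmetric powers, in a direction `h` so short that
the majorant is a convergent geometric series. -/
theorem IsMonogenic.hasSum_words (hΩ : IsOpen Ω) (hg : IsMonogenic g Ω)
    {a h : Fin (n + 1) → ℝ} {H Q M : ℝ} (hH : 0 ≤ H) (hQ : 0 ≤ Q)
    (hfH : ∀ j, ‖fueter h j‖ ≤ H) (hq : n * H * Q < 1)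
    (hmem : ∀ t ∈ Icc (0 : ℝ) 1, a + t • h ∈ Ω)
    (hbd : ∀ (l : List (Fin n)), ∀ t ∈ Icc (0 : ℝ) 1,
      ‖negPartials g l (a + t • h)‖ ≤ Q ^ l.length * (l.length)! * M) :
    HasSum (fun x : Σ k, Fin k → Fin n =>
      symProd (fun i => fueter h (x.2 i)) * ((x.1 ! : ℝ)⁻¹ • negPartials g (List.ofFn x.2) a))
      (g (a + h)) := by
  have ha : a ∈ Ω := by simpa using hmem 0 (by simp)
  have hword : ∀ k, ∑ w : Fin k → Fin n, symProd (fun i => fueter h (w i)) *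
      ((k ! : ℝ)⁻¹ • negPartials g (List.ofFn w) a) = (k ! : ℝ)⁻¹ • dirDeriv h k g a := by
    intro k
    rw [dirDeriv_eq_sum, sum_prod_word_eq_sum_symProd (fueter h)
      (G := fun w => negPartials g (List.ofFn w) a)
      (fun w σ => hg.negPartials_perm hΩ (σ.ofFn_comp_perm w) ha), Finset.smul_sum]
    simp only [mul_smul_comm]
  have hray : HasSum (fun k => (k ! : ℝ)⁻¹ • dirDeriv h k g a) (g (a + h)) := by
    have := hasSum_taylor (S := fun k t => dirDeriv h k g (a + t • h)) (M := ‖(1 : Cl n)‖ * M)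
      (by positivity) hq (fun k t ht => hg.hasDerivAt_dirDeriv hΩ a h (hmem t ht) k) (by
        intro k t ht
        rw [dirDeriv_eq_sum]
        refine (norm_sum_le_of_le (f := fun w : Fin k → Fin n =>
          (List.ofFn fun i => fueter h (w i)).prod * negPartials g (List.ofFn w) (a + t • h)) _
          fun w _ => ?_).trans_eq (b := ∑ _w : Fin k → Fin n,
            (H ^ k * ‖(1 : Cl n)‖) * (Q ^ k * k ! * M)) ?_
        · refine (norm_mul_le _ _).trans (mul_le_mul ?_ ?_ (norm_nonneg _) (by positivity))
          · refine (norm_list_prod_le_mul_pow hH _ fun x hx => ?_).trans_eq (by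
              rw [List.length_ofFn])
            obtain ⟨i, rfl⟩ := (List.mem_ofFn' _ _).1 hx
            exact hfH _
          · simpa using hbd (List.ofFn w) t ht
        · rw [Finset.sum_const, Finset.card_univ, Fintype.card_fun, Fintype.card_fin,
            Fintype.card_fin, nsmul_eq_mul]
          push_cast
          ring)
    simpa [dirDeriv] using this
  -- The `n^k` words of length `k` together contribute at most a constant times `(n H Q)^k`.
  have hsum : Summable fun x : Σ k, Fin k → Fin n => symProd (fun i => fueter h (x.2 i)) *
      ((x.1 ! : ℝ)⁻¹ • negPartials g (List.ofFn x.2) a) := by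
    refine Summable.of_norm_bounded
      (g := fun x => H ^ x.1 * ‖(1 : Cl n)‖ * (Q ^ x.1 * |M|)) ?_ fun x => ?_
    · rw [summable_sigma_of_nonneg fun x => by positivity]
      refine ⟨fun k => Summable.of_finite, ?_⟩
      refine ((summable_geometric_of_lt_one (by positivity) hq).mul_right
        (‖(1 : Cl n)‖ * |M|)).congr fun k => ?_
      dsimp only
      rw [tsum_fintype, Finset.sum_const, Finset.card_univ, Fintype.card_fun, Fintype.card_fin,
        Fintype.card_fin, nsmul_eq_mul]
      push_cast
      ring
    · refine (norm_mul_le _ _).trans (mul_le_mul (norm_symProd_le hH _ fun i => hfH _) ?_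
        (norm_nonneg _) (by positivity))
      have hk : (0 : ℝ) < x.1 ! := by positivity
      rw [norm_smul, norm_inv, Real.norm_of_nonneg hk.le, inv_mul_le_iff₀ hk]
      have h1 := hbd (List.ofFn x.2) 0 (by simp)
      simp only [zero_smul, add_zero, List.length_ofFn] at h1
      refine h1.trans ?_
      calc _ ≤ Q ^ x.1 * x.1 ! * |M| := by gcongr; exact le_abs_self M
        _ = _ := by ring
  -- Absolute summability permits grouping by length, which identifies the sum with that of the
  -- Taylor series along the segment.
  have h2 := hsum.hasSum.sigma fun k => hasSum_fintype _
  simp only [hword] at h2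
  rw [← h2.unique hray]
  exact hsum.hasSum

theorem IsMonogenic.exists_hasSum_symPow (hΩ : IsOpen Ω) (hg : IsMonogenic g Ω)
    {a : Fin (n + 1) → ℝ} (ha : a ∈ Ω) : ∃ c : (Fin n → ℕ) → Cl n, ∀ᶠ h in 𝓝 0,
      HasSum (fun β => symPow (fueter h) β * c β) (g (a + h)) := by
  obtain ⟨R, hR, hs⟩ := Metric.nhds_basis_closedBall.mem_iff.1 (hΩ.mem_nhds ha)
  obtain ⟨M, hM⟩ := (isCompact_closedBall a R).exists_bound_of_continuousOn
    (hg.differentiableOn.continuousOn.mono hs)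
  obtain ⟨H, hH, hfH⟩ := exists_norm_fueter_le n
  -- Half of `R` is reserved for moving along the segment, the other half for the derivative
  -- estimate at its points.
  set Q := 2 * derivConst n * Real.exp 1 / (R / 2) with hQdef
  have hQ : 0 ≤ Q := by
    have := derivConst_nonneg n
    positivity
  -- A finite sum over the `|β|!/β!` words with multi-index `β`; its value is `(-1)^|β| ∂^β g(a) /
  -- β!`.
  refine ⟨fun β => ∑' x : {x : Σ k, Fin k → Fin n // wordCount x.2 = β},
    ((x.1.1 ! : ℝ)⁻¹ • negPartials g (List.ofFn x.1.2) a), ?_⟩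
  have hsmall : ∀ᶠ h : Fin (n + 1) → ℝ in 𝓝 0, n * (‖h‖ * H) * Q < 1 := by
    have : Continuous fun h : Fin (n + 1) → ℝ => n * (‖h‖ * H) * Q := by fun_prop
    refine this.tendsto 0 |>.eventually_lt_const ?_
    simp
  filter_upwards [hsmall, closedBall_mem_nhds (0 : Fin (n + 1) → ℝ) (half_pos hR)] with h hq hh
  rw [mem_closedBall_zero_iff] at hh
  have hsub : ∀ t ∈ Icc (0 : ℝ) 1, closedBall (a + t • h) (R / 2) ⊆ closedBall a R := by
    intro t ht
    refine closedBall_subset_closedBall' ?_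
    rw [dist_eq_norm, add_sub_cancel_left, norm_smul, Real.norm_of_nonneg ht.1]
    nlinarith [ht.2, norm_nonneg h]
  have h1 := hg.hasSum_words hΩ (a := a) (h := h) (M := M) (by positivity) hQ (hfH h) hq
    (fun t ht => hs (hsub t ht (mem_closedBall_self (by positivity))))
    (fun l t ht => hg.norm_negPartials_le_factorial hΩ (half_pos hR) ((hsub t ht).trans hs)
      (fun y hy => hM y (hsub t ht hy)) l)
  rw [← (Equiv.sigmaFiberEquiv fun x : Σ k, Fin k → Fin n => wordCount x.2).hasSum_iff] at h1
  refine h1.sigma fun β => ?_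
  have := finite_wordCount_fiber β
  have hfin : Summable fun x : {x : Σ k, Fin k → Fin n // wordCount x.2 = β} =>
    ((x.1.1 ! : ℝ)⁻¹ • negPartials g (List.ofFn x.1.2) a) := Summable.of_finite
  have h2 := hfin.hasSum.mul_left (symPow (fueter h) β)
  refine (congrArg (HasSum · _) (funext fun x => ?_)).mp h2
  obtain ⟨x, rfl⟩ := x
  rw [← symProd_comp_word]
  rfl
end TaylorSeries

/-! ### Transfer between monogenic functions and solutions of `D f = f λ` -/

section LambdaMonogenic

variable {n : ℕ} {lam : Cl n}

theorem hasFDerivAt_exp_coord_smul (lam : Cl n) (y : Fin (n + 1) → ℝ) :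
    HasFDerivAt (fun y : Fin (n + 1) → ℝ => NormedSpace.exp (y 0 • lam))
      ((ContinuousLinearMap.proj (R := ℝ) (φ := fun _ => ℝ) (0 : Fin (n + 1))).smulRight
        (NormedSpace.exp (y 0 • lam) * lam)) y := by
  have h := (hasDerivAt_exp_smul_const lam (y 0)).hasFDerivAt.comp y
    (hasFDerivAt_apply (𝕜 := ℝ) (0 : Fin (n + 1)) y)
  refine h.congr_fderiv ?_
  ext v
  simp

theorem expLam_add (lam : Cl n) (y h : Pt n) :
    expLam lam (y + h) = expLam lam y * expLam lam h := by
  rw [expLam, expLam, expLam, PiLp.add_apply, add_smul]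
  let _ : NormedAlgebra ℚ (Cl n) := NormedAlgebra.restrictScalars ℚ ℝ (Cl n)
  exact NormedSpace.exp_add_of_commute (((Commute.refl lam).smul_left _).smul_right _)

theorem expLam_zero (lam : Cl n) : expLam lam 0 = 1 := by
  simp [expLam]

theorem continuous_expLam (lam : Cl n) : Continuous (expLam lam) := by
  have h : Continuous fun y : Pt n => y 0 • lam := by fun_prop
  let _ : NormedAlgebra ℚ (Cl n) := NormedAlgebra.restrictScalars ℚ ℝ (Cl n)
  exact NormedSpace.exp_continuous.comp h

theorem expLam_neg_mul (lam : Cl n) (y : Pt n) : expLam lam (-y) * expLam lam y = 1 := by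
  rw [← expLam_add, neg_add_cancel, expLam_zero]

theorem monom_sub (y a : Pt n) (j : Fin n) : monom y j - monom a j = monom (y - a) j := by
  simp only [monom, PiLp.sub_apply, sub_smul]
  abel

/-- Right multiplication by `e^{-y₀ λ}` turns solutions of `D f = f λ` into monogenic functions. -/
theorem LambdaMonogenic.isMonogenic {Ω : Set (Pt n)} (hΩ : IsOpen Ω) {f : Pt n → Cl n}
    (hf : LambdaMonogenic lam Ω f) :
    IsMonogenic (fun y : Fin (n + 1) → ℝ => f (WithLp.toLp 2 y) * expLam lam (-WithLp.toLp 2 y))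
      (WithLp.toLp 2 ⁻¹' Ω) := by
  let T : (Fin (n + 1) → ℝ) →L[ℝ] Pt n :=
    (PiLp.continuousLinearEquiv 2 ℝ (fun _ : Fin (n + 1) => ℝ)).symm
  have hT : ∀ y, T y = WithLp.toLp 2 y := fun _ => rfl
  have hexp : (fun y : Fin (n + 1) → ℝ => expLam lam (-WithLp.toLp 2 y)) =
      fun y => NormedSpace.exp (y 0 • -lam) := by
    funext y
    simp [expLam]
  have hd : ∀ y ∈ WithLp.toLp 2 ⁻¹' Ω,
      HasFDerivAt (fun y : Fin (n + 1) → ℝ => f (T y) * NormedSpace.exp (y 0 • -lam))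
        (f (T y) • ((ContinuousLinearMap.proj (R := ℝ) (φ := fun _ => ℝ)
          (0 : Fin (n + 1))).smulRight (NormedSpace.exp (y 0 • -lam) * -lam)) +
          MulOpposite.op (NormedSpace.exp (y 0 • -lam)) • (fderiv ℝ f (T y)).comp T) y := by
    intro y hy
    have h1 : HasFDerivAt f (fderiv ℝ f (T y)) (T y) :=
      ((hf.differentiableOn _ hy).differentiableAt (hΩ.mem_nhds hy)).hasFDerivAt
    exact (h1.comp y T.hasFDerivAt).mul' (hasFDerivAt_exp_coord_smul (-lam) y)
  have hfun : (fun y : Fin (n + 1) → ℝ => f (WithLp.toLp 2 y) * expLam lam (-WithLp.toLp 2 y)) =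
      fun y : Fin (n + 1) → ℝ => f (T y) * NormedSpace.exp (y 0 • -lam) := by
    funext y
    rw [← congrFun hexp y]
    rfl
  rw [hfun]
  refine ⟨fun y hy => (hd y hy).differentiableAt.differentiableWithinAt, fun y hy => ?_⟩
  rw [(hd y hy).fderiv]
  set E := NormedSpace.exp (y 0 • -lam) with hE
  -- This makes `f λ E`, coming from `D f`, cancel against `-f E λ`, coming from the exponential.
  have hcomm : lam * E = E * lam :=
    (((Commute.refl lam).neg_right.smul_right (y 0)).exp_right).eq
  have h2 : ∀ v : Fin (n + 1) → ℝ, (f (T y) • ((ContinuousLinearMap.proj (R := ℝ)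
      (φ := fun _ => ℝ) (0 : Fin (n + 1))).smulRight (E * -lam)) +
          MulOpposite.op E • (fderiv ℝ f (T y)).comp T) v =
      f (T y) * (v 0 • (E * -lam)) + fderiv ℝ f (T y) (T v) * E := fun v => rfl
  have h3 := hf.cauchyRiemann_eq _ hy
  simp only [cauchyRiemann, pderiv] at h3
  have h4 : ∀ i, T (Pi.single i 1) = EuclideanSpace.single i 1 := fun _ => rfl
  rw [Finset.sum_congr rfl fun i _ => congrArg (paravector n (Pi.single i 1) * ·) (h2 _)]
  simp only [h4, hT, mul_add, Finset.sum_add_distrib, ← mul_assoc, ← Finset.sum_mul]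
  rw [Fin.sum_univ_succ, Fin.sum_univ_succ, paravector_single_zero]
  simp only [paravector_single_succ, one_mul]
  rw [h3]
  simp [mul_assoc, hcomm]

/-- With `D = dg(y)`, the remainder is `(g(y+h) - g(y) - D h) e^{(y₀+h₀)λ} + D h (e^{(y₀+h₀)λ} -
e^{y₀λ})`: a little-o times a bounded factor, plus an `O(|h|)` times a factor tending to `0`. -/
theorem IsMonogenic.hasLambdaDerivAt {Ω : Set (Pt n)} (hΩ : IsOpen Ω) {f : Pt n → Cl n}
    {g : (Fin (n + 1) → ℝ) → Cl n} (hg : IsMonogenic g (WithLp.toLp 2 ⁻¹' Ω))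
    (hfg : ∀ y ∈ Ω, f y = g (WithLp.ofLp y) * expLam lam y) {y : Pt n} (hy : y ∈ Ω) :
    HasLambdaDerivAt lam f (fun j => _root_.negPartial j g (WithLp.ofLp y)) y := by
  let T : Pt n →L[ℝ] (Fin (n + 1) → ℝ) :=
    (PiLp.continuousLinearEquiv 2 ℝ (fun _ : Fin (n + 1) => ℝ))
  have hΩ' : IsOpen (WithLp.toLp 2 ⁻¹' Ω : Set (Fin (n + 1) → ℝ)) :=
    hΩ.preimage (PiLp.continuous_toLp 2 _)
  have hyy : T y ∈ (WithLp.toLp 2 ⁻¹' Ω : Set (Fin (n + 1) → ℝ)) := hy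
  have hd := ((hg.hasFDerivAt hΩ' hyy).comp y T.hasFDerivAt)
  let D := (fderiv ℝ g (T y)).comp T
  have hD : ∀ h, D h = ∑ j, monom h j * _root_.negPartial j g (WithLp.ofLp y) := fun h =>
    hg.fderiv_apply hyy (T h)
  have hcont : Tendsto (fun h => expLam lam (y + h)) (𝓝 0) (𝓝 (expLam lam y)) := by
    have : Continuous fun h : Pt n => expLam lam (y + h) :=
      (continuous_expLam lam).comp (continuous_const.add continuous_id)
    simpa using this.tendsto 0
  have h1 := (hasFDerivAt_iff_isLittleO_nhds_zero.1 hd).norm_right.mul_isBigO (hcont.isBigO_one ℝ)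
  have h2 : (fun h => D h * (expLam lam (y + h) - expLam lam y)) =o[𝓝 0]
      fun h : Pt n => ‖h‖ * (1 : ℝ) := by
    refine (D.isBigO_id (𝓝 0)).norm_right.mul_isLittleO ?_
    rw [isLittleO_one_iff]
    simpa using hcont.sub_const (expLam lam y)
  refine ((h1.add h2).congr' ?_ (Eventually.of_forall fun h => mul_one _)).of_norm_right
  have hev : ∀ᶠ h : Pt n in 𝓝 0, y + h ∈ Ω := by
    have : Continuous fun h : Pt n => y + h := by fun_prop
    exact this.tendsto 0 (hΩ.mem_nhds (by simpa using hy))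
  filter_upwards [hev] with h hh
  have h3 : ((fderiv ℝ g (T y)).comp T) h = D h := rfl
  have h4 : (g ∘ T) (y + h) = g (WithLp.ofLp (y + h)) := rfl
  have h5 : (g ∘ T) y = g (WithLp.ofLp y) := rfl
  have h6 : ∑ j, monom h j * _root_.negPartial j g (WithLp.ofLp y) * expLam lam y =
      D h * expLam lam y := by
    rw [hD, Finset.sum_mul]
  rw [h3, h4, h5, h6, hfg _ hh, hfg _ hy, sub_mul, sub_mul, mul_sub, expLam_add, mul_assoc]
  abel

/-- The coefficients `-∂_j g e^{y₀λ}` are again a monogenic function times `e^{y₀λ}`, so the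
induction runs over all such pairs `f`, `g`. -/
theorem IsMonogenic.lambdaDifferentiableOn {Ω : Set (Pt n)} (hΩ : IsOpen Ω) (k : ℕ) :
    ∀ {f : Pt n → Cl n} {g : (Fin (n + 1) → ℝ) → Cl n},
      IsMonogenic g (WithLp.toLp 2 ⁻¹' Ω) →
      (∀ y ∈ Ω, f y = g (WithLp.ofLp y) * expLam lam y) → LambdaDifferentiableOn lam Ω k f := by
  induction k with
  | zero => intro f g _ _; trivial
  | succ k ih =>
    intro f g hg hfg
    exact ⟨fun j y => _root_.negPartial j g (WithLp.ofLp y),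
      fun y hy => hg.hasLambdaDerivAt hΩ hfg hy,
      fun j => ih (hg.negPartial (hΩ.preimage (PiLp.continuous_toLp 2 _)) j) fun y _ => rfl⟩

end LambdaMonogenic

theorem mainTheorem7 {n : ℕ} (lam : Cl n) (Ω : Set (Pt n)) (hΩ : IsOpen Ω)
    (f : Pt n → Cl n) (hf : LambdaMonogenic lam Ω f) :
    InfinitelyLambdaDifferentiableOn lam Ω f ∧
      ∀ a ∈ Ω, ∃ c : (Fin n → ℕ) → Cl n, ∀ᶠ y in 𝓝 a,
        HasSum (fun β => symPow (fun j => monom y j - monom a j) β * c β * expLam lam y) (f y) := by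
  have hg := hf.isMonogenic hΩ
  have hfg : ∀ y : Pt n, f y = f (WithLp.toLp 2 (WithLp.ofLp y)) *
      expLam lam (-WithLp.toLp 2 (WithLp.ofLp y)) * expLam lam y := fun y => by
    rw [WithLp.toLp_ofLp, mul_assoc, expLam_neg_mul, mul_one]
  refine ⟨fun k => hg.lambdaDifferentiableOn hΩ k fun y _ => hfg y, fun a ha => ?_⟩
  obtain ⟨c, hc⟩ := hg.exists_hasSum_symPow (hΩ.preimage (PiLp.continuous_toLp 2 _))
    (a := WithLp.ofLp a) ha
  refine ⟨c, ?_⟩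
  have hlim : Tendsto (fun y : Pt n => WithLp.ofLp (y - a)) (𝓝 a) (𝓝 0) := by
    have : Continuous fun y : Pt n => WithLp.ofLp (y - a) :=
      (PiLp.continuous_ofLp 2 _).comp (continuous_id.sub continuous_const)
    simpa using this.tendsto a
  filter_upwards [hlim.eventually hc] with y hy
  have h1 : WithLp.ofLp a + WithLp.ofLp (y - a) = WithLp.ofLp y := by
    rw [← WithLp.ofLp_add, add_sub_cancel]
  rw [h1] at hy
  have h2 := hy.mul_right (expLam lam y)
  rw [← hfg y] at h2
  simp only [monom_sub]
  exact h2
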